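/- Let $k$ be a field. For $g=(a_{ij})\in GL_4(k)$ let $g$ act on the rational function field $k(x_1,x_2,x_3,x_4)$ by the $k$-automorphism with $g\cdot x_j=\sum_{i=1}^4 a_{ij}x_i$ for $1\le j\le 4$. For a subgroup $G\subseteq GL_4(k)$ let $k(x_1,x_2,x_3,x_4)^G$ be the field of all $f\in k(x_1,x_2,x_3,x_4)$ with $g\cdot f=f$ for all $g\in G$, and let $k(x_1/x_4,x_2/x_4,x_3/x_4)^G$ be the field of all such $f$ that lie in the subfield $k(x_1/x_4,x_2/x_4,x_3/x_4)$. A field extension $K/k$ is called rational if $K=k(t_1,\dots,t_n)$ for some $n$ and some $t_1,\dots,t_n\in K$ that are algebraically independent over $k$. If $\operatorname{char}k\ne 2$, define the following elements of $GL_4(k)$: $$\lambda_1=\begin{pmatrix}0&-1&0&0\\1&0&0&0\\0&0&0&1\\0&0&-1&0\end{pmatrix},\quad \lambda_2=\begin{pmatrix}0&0&-1&0\\0&0&0&-1\\1&0&0&0\\0&1&0&0\end{pmatrix},\quad \sigma=\frac12\begin{pmatrix}-1&1&1&1\\-1&-1&-1&1\\-1&1&-1&-1\\-1&-1&1&-1\end{pmatrix},$$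 $$\tau=\begin{pmatrix}0&0&-1&0\\0&-1&0&0\\-1&0&0&0\\0&0&0&1\end{pmatrix},\quad \lambda_3=\frac12\begin{pmatrix}-1&1&1&-1\\-1&-1&-1&-1\\-1&1&-1&1\\1&1&-1&-1\end{pmatrix},\quad \lambda_4=\begin{pmatrix}1&0&0&0\\0&0&0&1\\0&0&-1&0\\0&1&0&0\end{pmatrix}.$$ Let $(4,33,3)=\langle\lambda_1,\lambda_2,\sigma\rangle$, $(4,33,6)=\langle\lambda_1,\lambda_2,\sigma,\tau\rangle$, $(4,33,7)=\langle\lambda_1,\lambda_2,\sigma,\lambda_3\rangle$ and $(4,33,11)=\langle\lambda_1,\lambda_2,\sigma,\lambda_3,\lambda_4\rangle$. **Theorem 1.3.** (1) Let $\operatorname{char}k\neq 2$ and let $G\subseteq GL_4(k)$ be a subgroup that is conjugate in $GL_4(k)$ to $(4,33,3)$ or to $(4,33,6)$. Then both $k(x_1,x_2,x_3,x_4)^G$ and $k(x_1/x_4,x_2/x_4,x_3/x_4)^G$ are rational over $k$. (2) Let $\operatorname{char}k\neq 2,3$ and let $G\subseteq GL_4(k)$ be a subgroup that is conjugate in $GL_4(k)$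 to $(4,33,7)$ or to $(4,33,11)$. Then both $k(x_1,x_2,x_3,x_4)^G$ and $k(x_1/x_4,x_2/x_4,x_3/x_4)^G$ are rational over $k$. -/

import Mathlib

namespace KangZhou

open MvPolynomial
open scoped Matrix

/-- `K / k` is rational: `K = k(x₁, …, xₙ)` for some `x₁, …, xₙ ∈ K` that are algebraically
independent over `k`. -/
def IsRational (k K : Type*) [Field k] [Field K] [Algebra k K] : Prop :=
  ∃ (n : ℕ) (x : Fin n → K),
    AlgebraicIndependent k x ∧ IntermediateField.adjoin k (Set.range x) = ⊤

section Action

variable (k : Type*) [Field k]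

/-- The rational function field `k(x₁, x₂, x₃, x₄)`. The variables `x₁, …, x₄` are indexed by
`0, …, 3 : Fin 4`. -/
abbrev RatFun4 : Type _ := FractionRing (MvPolynomial (Fin 4) k)

/-- The variable `x_j` as an element of `k(x₁, x₂, x₃, x₄)`. -/
noncomputable def var (j : Fin 4) : RatFun4 k :=
  algebraMap (MvPolynomial (Fin 4) k) (RatFun4 k) (X j)

variable {k}

/-- The linear substitution `x_j ↦ ∑ i, a_{ij} x_i` attached to the matrix `M = (a_{ij})`. -/
noncomputable def subst (M : Matrix (Fin 4) (Fin 4) k) :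
    MvPolynomial (Fin 4) k →ₐ[k] MvPolynomial (Fin 4) k :=
  aeval fun j => ∑ i, C (M i j) * X i

theorem subst_X (M : Matrix (Fin 4) (Fin 4) k) (j : Fin 4) :
    subst M (X j) = ∑ i, C (M i j) * X i := by
  simp [subst]

theorem subst_one : subst (1 : Matrix (Fin 4) (Fin 4) k) = AlgHom.id k _ := by
  refine MvPolynomial.algHom_ext fun j => ?_
  rw [subst_X, Finset.sum_eq_single j]
  · simp
  · intro b _ hb
    simp [Matrix.one_apply_ne hb]
  · simp

theorem subst_mul (M N : Matrix (Fin 4) (Fin 4) k) :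
    subst (M * N) = (subst M).comp (subst N) := by
  refine MvPolynomial.algHom_ext fun j => ?_
  have hC : ∀ a : k, subst M (C a) = C a := fun a => (subst M).commutes a
  simp only [AlgHom.comp_apply, subst_X, map_sum, map_mul, hC, Matrix.mul_apply,
    Finset.sum_mul, Finset.mul_sum]
  rw [Finset.sum_comm]
  refine Finset.sum_congr rfl fun i _ => Finset.sum_congr rfl fun l _ => ?_
  ring

/-- The action of `GL₄(k)` on `k[x₁, x₂, x₃, x₄]` by `g · x_j = ∑ i, g_{ij} x_i`. -/
noncomputable def polyAct :
    GL (Fin 4) k →* (MvPolynomial (Fin 4) k ≃ₐ[k] MvPolynomial (Fin 4) k) where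
  toFun g := AlgEquiv.ofAlgHom (subst (g : Matrix (Fin 4) (Fin 4) k))
    (subst ((g⁻¹ : GL (Fin 4) k) : Matrix (Fin 4) (Fin 4) k))
    (by rw [← subst_mul, Units.mul_inv, subst_one])
    (by rw [← subst_mul, Units.inv_mul, subst_one])
  map_one' := by
    refine AlgEquiv.ext fun p => ?_
    simp [subst_one]
  map_mul' g h := by
    refine AlgEquiv.ext fun p => ?_
    simp [subst_mul]

/-- The action of `GL₄(k)` on `k(x₁, x₂, x₃, x₄)` by the `k`-automorphisms
`g · x_j = ∑ i, g_{ij} x_i`. -/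
noncomputable def ratAct : GL (Fin 4) k →* (RatFun4 k ≃ₐ[k] RatFun4 k) :=
  (IsFractionRing.fieldEquivOfAlgEquivHom k (RatFun4 k)).comp polyAct

theorem ratAct_var (g : GL (Fin 4) k) (j : Fin 4) :
    ratAct g (var k j) = ∑ i, algebraMap k (RatFun4 k) (g i j) * var k i := by
  have h : ratAct g (var k j) = algebraMap (MvPolynomial (Fin 4) k) (RatFun4 k)
      (subst (g : Matrix (Fin 4) (Fin 4) k) (X j)) :=
    IsFractionRing.fieldEquivOfAlgEquiv_algebraMap _ _ _ (polyAct g) (X j)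
  rw [h, subst_X, map_sum]
  refine Finset.sum_congr rfl fun i _ => ?_
  rw [map_mul, IsScalarTower.algebraMap_apply k (MvPolynomial (Fin 4) k) (RatFun4 k)]
  rfl

/-- The fixed field `k(x₁, x₂, x₃, x₄)^G`. -/
noncomputable def fixedField (G : Subgroup (GL (Fin 4) k)) : IntermediateField k (RatFun4 k) :=
  IntermediateField.fixedField (G.map ratAct)

theorem mem_fixedField (G : Subgroup (GL (Fin 4) k)) (f : RatFun4 k) :
    f ∈ fixedField G ↔ ∀ g ∈ G, ratAct g f = f := by
  constructor
  · intro h g hg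
    exact h ⟨ratAct g, Subgroup.mem_map_of_mem _ hg⟩
  · rintro h ⟨e, he⟩
    obtain ⟨g, hg, rfl⟩ := Subgroup.mem_map.mp he
    exact h g hg

variable (k) in
/-- The subfield `k(x₁/x₄, x₂/x₄, x₃/x₄)` of `k(x₁, x₂, x₃, x₄)`. -/
noncomputable def projField : IntermediateField k (RatFun4 k) :=
  IntermediateField.adjoin k {var k 0 / var k 3, var k 1 / var k 3, var k 2 / var k 3}

/-- The fixed field `k(x₁/x₄, x₂/x₄, x₃/x₄)^G`. -/
noncomputable def projFixedField (G : Subgroup (GL (Fin 4) k)) :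
    IntermediateField k (RatFun4 k) :=
  projField k ⊓ fixedField G

end Action

section Groups

variable (k : Type*) [Field k]

def lam1 : Matrix (Fin 4) (Fin 4) k :=
  !![0, -1, 0, 0;
     1,  0, 0, 0;
     0,  0, 0, 1;
     0,  0, -1, 0]

def lam2 : Matrix (Fin 4) (Fin 4) k :=
  !![0, 0, -1,  0;
     0, 0,  0, -1;
     1, 0,  0,  0;
     0, 1,  0,  0]

def sig : Matrix (Fin 4) (Fin 4) k :=
  (1 / 2 : k) •
    !![-1,  1,  1,  1;
       -1, -1, -1,  1;
       -1,  1, -1, -1;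
       -1, -1,  1, -1]

def tau : Matrix (Fin 4) (Fin 4) k :=
  !![ 0,  0, -1, 0;
      0, -1,  0, 0;
     -1,  0,  0, 0;
      0,  0,  0, 1]

def lam3 : Matrix (Fin 4) (Fin 4) k :=
  (1 / 2 : k) •
    !![-1,  1,  1, -1;
       -1, -1, -1, -1;
       -1,  1, -1,  1;
        1,  1, -1, -1]

def lam4 : Matrix (Fin 4) (Fin 4) k :=
  !![1, 0,  0, 0;
     0, 0,  0, 1;
     0, 0, -1, 0;
     0, 1,  0, 0]

/-- The matrices used below are orthogonal, hence invertible, as soon as `2 ≠ 0` in `k`. -/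
theorem generators_invertible (h2 : (2 : k) ≠ 0) :
    ∀ M ∈ ({lam1 k, lam2 k, sig k, tau k, lam3 k, lam4 k} : Set (Matrix (Fin 4) (Fin 4) k)),
      ∃ g : GL (Fin 4) k, (g : Matrix (Fin 4) (Fin 4) k) = M := by
  have key : ∀ M : Matrix (Fin 4) (Fin 4) k, Mᵀ * M = 1 →
      ∃ g : GL (Fin 4) k, (g : Matrix (Fin 4) (Fin 4) k) = M := fun M h =>
    ⟨⟨M, Mᵀ, mul_eq_one_comm.mp h, h⟩, rfl⟩
  rintro M (rfl | rfl | rfl | rfl | rfl | rfl) <;> refine key _ ?_ <;> ext i j <;>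
    fin_cases i <;> fin_cases j <;>
    simp [lam1, lam2, sig, tau, lam3, lam4, Matrix.mul_apply, Fin.sum_univ_four] <;>
    (field_simp; norm_num)

variable {k} in
/-- The subgroup of `GL₄(k)` generated by the matrices in `S`. -/
def generatedBy (S : Set (Matrix (Fin 4) (Fin 4) k)) : Subgroup (GL (Fin 4) k) :=
  Subgroup.closure {g | (g : Matrix (Fin 4) (Fin 4) k) ∈ S}

/-- The group `(4, 33, 3)` over `k`, for `char k ≠ 2`. -/
def group3 : Subgroup (GL (Fin 4) k) := generatedBy {lam1 k, lam2 k, sig k}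

/-- The group `(4, 33, 6)` over `k`, for `char k ≠ 2`. -/
def group6 : Subgroup (GL (Fin 4) k) := generatedBy {lam1 k, lam2 k, sig k, tau k}

/-- The group `(4, 33, 7)` over `k`, for `char k ≠ 2`. -/
def group7 : Subgroup (GL (Fin 4) k) := generatedBy {lam1 k, lam2 k, sig k, lam3 k}

/-- The group `(4, 33, 11)` over `k`, for `char k ≠ 2`. -/
def group11 : Subgroup (GL (Fin 4) k) := generatedBy {lam1 k, lam2 k, sig k, lam3 k, lam4 k}

variable {k} in
/-- `G` is conjugate to `H` within `GL₄(k)`: `G = P H P⁻¹` for some `P`. -/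
def InClassOf (G H : Subgroup (GL (Fin 4) k)) : Prop :=
  ∃ P : GL (Fin 4) k, G = H.map (MulAut.conj P).toMonoidHom

end Groups

end KangZhou

/-!
Regard `x₁, …, x₄` as the coordinates of a generic quaternion. Its rotation matrix `rot` has entries
in `k(x₁/x₄, x₂/x₄, x₃/x₄)` and generates this field (`div_mem_of_rot_mem`). The groups act on it by
signed permutations of rows and columns: `lam1`, `lam2` change the signs of two rows, `sig` permutes
the rows cyclically, `lam3` permutes the columns cyclically up to signs, and `tau`, `lam4` reverse
both rows and columns up to signs.

A rotation matrix is determined by two perpendicular combinations of its columns, an axis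
`(a, b, c)` of square norm `κ` and a vector `d`; let `e` be their cross product (`Frame`). For the
group generated by `lam1`, `lam2`, `sig` the sign changes leave `p = bc/a`, `q = ca/b`, `r = ab/c`,
with `pq + qr + rp = κ`, and the products `f₁`, `f₂` of `d`, `e` with `(1/a, 1/b, 1/c)`. The cyclic
invariants of `p`, `q`, `r` are the rational functions in the two elements `u`, `v`, so the field of
invariants is generated by `u`, `v`, `f₁`, `f₂`, subject to one relation that expresses the norm of
`f₁ + f₂ / √-κ` by `u`, `v`. The change of variables from `f₁`, `f₂` to `X`, `Y` turns this relation
into `lam (X² + κ Y²) + κ w² = κ² t` with `w = (u² - uv + v²) / u` and `t = v / u`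
(`Frame.quadric`). Since `t` is a polynomial in `X`, `Y`, `w`, these three elements generate
(`Frame.descent`).

For the larger groups the axis is chosen to be preserved up to sign and order: the middle column for
`tau`, the axis of the signed cyclic permutation of the columns for `lam3`, `lam4`. Then `lam3`
multiplies `z = X + √-3 Y` by a cube root of unity, and the components of `z³ / |z|²` together with
`w` generate the invariants (`Descent.rotation`). Both `tau` and `lam4` divide three generators,
up to one sign, by a diagonal quadratic form in them that equals `t`; the invariants of such an
involution are generated by three explicit elements (`Descent.inversion`).

Generation is proved one extension of degree two or three at a time: an element of `M(θ)` fixed by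
an automorphism over `M` that moves `θ` lies in `M` (`mem_of_map_eq_self`). No order of a group is
needed. As the same towers show that everything is algebraic over the generators, these are
algebraically independent by counting (`algebraicIndependent_of_isAlgebraic`). For the field
`k(x₁, …, x₄)` the sum of squares of the variables is a fourth generator, because all the groups are
orthogonal and contain `-1`.
-/

namespace KangZhou

/-! ### Descending through extensions of degree two and three -/

section

open Polynomial

variable {k E : Type*} [Field k] [Field E] [Algebra k E]

/-- An element of `M(θ)`, where `θ` has degree at most three over `M`, already lies in `M` as soon
as it is fixed by one automorphism `g` over `M` that moves `θ`: a field strictly between `M` and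
`M(θ)` is excluded by the degree. The automorphism `g` need not preserve `M(θ)`. -/
theorem mem_of_map_eq_self (M : IntermediateField k E) {θ : E} (P : M[X]) (hP : P.Monic)
    (hdeg : P.natDegree ≤ 3) (hroot : aeval θ P = 0) (g : E ≃ₐ[k] E)
    (hM : ∀ x ∈ M, g x = x) (hθ : g θ ≠ θ) {f : E}
    (hf : f ∈ M ⊔ IntermediateField.adjoin k {θ}) (hgf : g f = f) : f ∈ M := by
  have hint : IsIntegral M θ := ⟨P, hP, hroot⟩
  set L : IntermediateField M E := IntermediateField.adjoin M {θ} with hL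
  have hfL : f ∈ L := by
    have := IntermediateField.restrictScalars_adjoin_eq_sup k M {θ}
    rw [← this] at hf
    exact hf
  have hfd : FiniteDimensional M L := IntermediateField.adjoin.finiteDimensional hint
  have hrank : Module.finrank M L ≤ 3 := by
    rw [hL, IntermediateField.adjoin.finrank hint]
    exact (natDegree_le_of_dvd (minpoly.dvd M θ hroot) hP.ne_zero).trans hdeg
  set N : IntermediateField M E := IntermediateField.adjoin M {f} with hN
  have hNL : N ≤ L := IntermediateField.adjoin_simple_le_iff.2 hfL
  -- `g` fixes `M(f)` pointwise but moves `θ`, so `M(f)` is a proper subfield of `M(θ)`.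
  have hgN : ∀ x ∈ N, g x = x := by
    intro x hx
    induction hx using IntermediateField.adjoin_induction with
    | mem x hx => rw [Set.mem_singleton_iff.1 hx, hgf]
    | algebraMap x => exact hM _ x.2
    | add x y _ _ hx hy => rw [map_add, hx, hy]
    | inv x _ hx => rw [map_inv₀, hx]
    | mul x y _ _ hx hy => rw [map_mul, hx, hy]
  have hmul := IntermediateField.finrank_bot_mul_relfinrank hNL
  have hNL' : IntermediateField.relfinrank N L ≠ 1 := fun h =>
    hθ (hgN θ (IntermediateField.relfinrank_eq_one_iff.1 h
      (IntermediateField.mem_adjoin_simple_self M θ)))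
  have hpos : 0 < Module.finrank M L := Module.finrank_pos
  have hN1 : Module.finrank M N = 1 := by
    have h1 : Module.finrank M N * IntermediateField.relfinrank N L ≤ 3 := hmul ▸ hrank
    have h2 : 0 < Module.finrank M N * IntermediateField.relfinrank N L := hmul ▸ hpos
    have h3 := Nat.pos_of_mul_pos_left h2
    have h4 := Nat.pos_of_mul_pos_right h2
    by_contra hne
    have : 2 ≤ Module.finrank M N := by omega
    have : 2 ≤ IntermediateField.relfinrank N L := by omega
    nlinarith
  have : f ∈ (⊥ : IntermediateField M E) := by
    rw [← IntermediateField.finrank_eq_one_iff.1 hN1]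
    exact IntermediateField.mem_adjoin_simple_self M f
  obtain ⟨y, hy⟩ := IntermediateField.mem_bot.1 this
  rw [← hy]
  exact y.2

theorem isAlgebraic_of_mem_sup (M : IntermediateField k E) {θ : E} (hθ : IsAlgebraic M θ) {f : E}
    (hf : f ∈ M ⊔ IntermediateField.adjoin k {θ}) : IsAlgebraic M f := by
  rw [← IntermediateField.restrictScalars_adjoin_eq_sup k M {θ}] at hf
  have hfL : f ∈ IntermediateField.adjoin M {θ} := hf
  have := IntermediateField.isAlgebraic_adjoin_simple hθ.isIntegral
  exact IntermediateField.isAlgebraic_iff.1 (this.isAlgebraic ⟨f, hfL⟩)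

theorem isAlgebraic_trans {M L : IntermediateField k E} (hL : ∀ x ∈ L, IsAlgebraic M x)
    {f : E} (hf : IsAlgebraic L f) : IsAlgebraic M f := by
  have hLC : L ≤ (algebraicClosure M E).restrictScalars k := fun x hx =>
    mem_algebraicClosure_iff.2 (hL x hx)
  have h : IsAlgebraic (algebraicClosure M E) f := by
    let φ : L →+* algebraicClosure M E := (IntermediateField.inclusion hLC).toRingHom
    obtain ⟨p, hp, hpf⟩ := hf
    refine ⟨p.map φ, (Polynomial.map_ne_zero_iff φ.injective).2 hp, ?_⟩
    rw [aeval_def, eval₂_map]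
    exact hpf
  exact IsAlgebraic.restrictScalars M h

/-- `Descent Γ L M`: `M` contains every element of `L` fixed by all of `Γ`, and `L` is algebraic
over `M`. The elements of `M` are not required to be fixed by `Γ`, nor is `L` required to be
stable under `Γ`, which is what makes the notion transitive along a tower of one-generator
extensions, each handled by a single automorphism. -/
structure Descent (Γ : Set (E ≃ₐ[k] E)) (L M : IntermediateField k E) : Prop where
  mem : ∀ f ∈ L, (∀ g ∈ Γ, g f = f) → f ∈ M
  isAlgebraic : ∀ f ∈ L, IsAlgebraic M f

theorem Descent.trans {Γ : Set (E ≃ₐ[k] E)} {L M N : IntermediateField k E}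
    (h₁ : Descent Γ L M) (h₂ : Descent Γ M N) : Descent Γ L N :=
  ⟨fun f hf hg => h₂.mem f (h₁.mem f hf hg) hg,
    fun f hf => isAlgebraic_trans h₂.isAlgebraic (h₁.isAlgebraic f hf)⟩

theorem Descent.mono {Γ Γ' : Set (E ≃ₐ[k] E)} {L L' M : IntermediateField k E}
    (h : Descent Γ L M) (hΓ : Γ ⊆ Γ') (hL : L' ≤ L) : Descent Γ' L' M :=
  ⟨fun f hf hg => h.mem f (hL hf) fun g hg' => hg g (hΓ hg'), fun f hf => h.isAlgebraic f (hL hf)⟩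

theorem map_eq_self_of_mem_adjoin {S : Set E} {g : E ≃ₐ[k] E} (h : ∀ x ∈ S, g x = x) :
    ∀ x ∈ IntermediateField.adjoin k S, g x = x := by
  intro x hx
  induction hx using IntermediateField.adjoin_induction with
  | mem x hx => exact h x hx
  | algebraMap x => exact g.commutes x
  | add x y _ _ hx hy => rw [map_add, hx, hy]
  | inv x _ hx => rw [map_inv₀, hx]
  | mul x y _ _ hx hy => rw [map_mul, hx, hy]

theorem Descent.of_cubic {Γ : Set (E ≃ₐ[k] E)} {S : Set E} {θ s t n : E} {g : E ≃ₐ[k] E}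
    (hg : g ∈ Γ) (hS : ∀ x ∈ S, g x = x) (hs : s ∈ IntermediateField.adjoin k S)
    (ht : t ∈ IntermediateField.adjoin k S) (hn : n ∈ IntermediateField.adjoin k S)
    (hroot : θ ^ 3 + s * θ ^ 2 + t * θ + n = 0) (hθ : g θ ≠ θ) :
    Descent Γ (IntermediateField.adjoin k S ⊔ IntermediateField.adjoin k {θ})
      (IntermediateField.adjoin k S) := by
  set M := IntermediateField.adjoin k S
  let P : M[X] := X ^ 3 + C ⟨s, hs⟩ * X ^ 2 + C ⟨t, ht⟩ * X + C ⟨n, hn⟩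
  have hP : P.Monic := by simp only [P]; monicity!
  have hdeg : P.natDegree ≤ 3 := by simp only [P]; compute_degree
  have haeval : aeval θ P = 0 := by
    simp only [P, map_add, map_mul, map_pow, aeval_X, aeval_C]
    exact hroot
  exact ⟨fun f hf hfix => mem_of_map_eq_self M P hP hdeg haeval g (map_eq_self_of_mem_adjoin hS)
    hθ hf (hfix g hg), fun f hf => isAlgebraic_of_mem_sup M ⟨P, hP.ne_zero, haeval⟩ hf⟩

theorem Descent.of_quadratic {Γ : Set (E ≃ₐ[k] E)} {S : Set E} {θ s n : E} {g : E ≃ₐ[k] E}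
    (hg : g ∈ Γ) (hS : ∀ x ∈ S, g x = x) (hs : s ∈ IntermediateField.adjoin k S)
    (hn : n ∈ IntermediateField.adjoin k S)
    (hroot : θ ^ 2 + s * θ + n = 0) (hθ : g θ ≠ θ) :
    Descent Γ (IntermediateField.adjoin k S ⊔ IntermediateField.adjoin k {θ})
      (IntermediateField.adjoin k S) :=
  .of_cubic hg hS hs hn (zero_mem _) (by linear_combination θ * hroot) hθ

open IntermediateField.algebraAdjoinAdjoin in
/-- A family of `n` elements over which `E` is algebraic is independent if `E` contains `n`
independent elements. -/
theorem algebraicIndependent_of_isAlgebraic {n : ℕ} {v x : Fin n → E}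
    (hv : AlgebraicIndependent k v)
    (h : ∀ f : E, IsAlgebraic (IntermediateField.adjoin k (Set.range x)) f) :
    AlgebraicIndependent k x := by
  have : Algebra.IsAlgebraic (Algebra.adjoin k (Set.range x)) E :=
    ⟨fun f => (IsFractionRing.isAlgebraic_iff (Algebra.adjoin k (Set.range x))
      (IntermediateField.adjoin k (Set.range x)) E).2 (h f)⟩
  refine (Algebra.IsAlgebraic.isTranscendenceBasis_of_lift_le_trdeg_of_finite k x ?_).1
  exact hv.lift_cardinalMk_le_trdeg

end

/-! ### Purely transcendental fixed fields and conjugation -/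

theorem algebraicIndependent_var (k : Type*) [Field k] : AlgebraicIndependent k (var k) :=
  (MvPolynomial.algebraicIndependent_X (Fin 4) k).map'
    (f := IsScalarTower.toAlgHom k (MvPolynomial (Fin 4) k) (RatFun4 k))
    (IsFractionRing.injective (MvPolynomial (Fin 4) k) (RatFun4 k))

/-- An intermediate field generated by finitely many algebraically independent elements. -/
def IsPurelyGenerated {k E : Type*} [Field k] [Field E] [Algebra k E]
    (F : IntermediateField k E) : Prop :=
  ∃ (n : ℕ) (x : Fin n → E), AlgebraicIndependent k x ∧ IntermediateField.adjoin k (Set.range x) = F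

section
variable {k E : Type*} [Field k] [Field E] [Algebra k E]

theorem IsPurelyGenerated.isRational {F : IntermediateField k E} (h : IsPurelyGenerated F) :
    IsRational k F := by
  obtain ⟨n, x, hx, rfl⟩ := h
  let y : Fin n → IntermediateField.adjoin k (Set.range x) :=
    fun i => ⟨x i, IntermediateField.subset_adjoin _ _ ⟨i, rfl⟩⟩
  refine ⟨n, y, ?_, ?_⟩
  · exact AlgebraicIndependent.of_comp (IntermediateField.val _) hx
  · apply IntermediateField.lift_injective
    rw [IntermediateField.lift_adjoin, IntermediateField.lift_top, ← Set.range_comp]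
    rfl

theorem IsPurelyGenerated.map {F : IntermediateField k E} (h : IsPurelyGenerated F)
    (e : E →ₐ[k] E) : IsPurelyGenerated (F.map e) := by
  obtain ⟨n, x, hx, rfl⟩ := h
  refine ⟨n, e ∘ x, hx.map' e.injective, ?_⟩
  rw [IntermediateField.adjoin_map, Set.range_comp]
end

section
variable {k : Type*} [Field k]

theorem var_ne_zero (j : Fin 4) : var k j ≠ 0 := (algebraicIndependent_var k).ne_zero j

theorem var_div_mem_projField (j : Fin 4) : var k j / var k 3 ∈ projField k := by
  fin_cases j
  · exact IntermediateField.subset_adjoin _ _ (by simp)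
  · exact IntermediateField.subset_adjoin _ _ (by simp)
  · exact IntermediateField.subset_adjoin _ _ (by simp)
  · simp [div_self (var_ne_zero (k := k) 3)]

theorem ratAct_var_div_mem_projField (P : GL (Fin 4) k) (i j : Fin 4) :
    ratAct P (var k i / var k j) ∈ projField k := by
  have h : ∀ l, ratAct P (var k l) / var k 3 ∈ projField k := by
    intro l
    rw [ratAct_var, Finset.sum_div]
    refine sum_mem fun m _ => ?_
    rw [mul_div_assoc]
    exact mul_mem ((projField k).algebraMap_mem _) (var_div_mem_projField m)
  rw [map_div₀, ← div_div_div_cancel_right₀ (var_ne_zero (k := k) 3)]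
  exact div_mem (h i) (h j)

theorem map_ratAct_projField_le (P : GL (Fin 4) k) :
    (projField k).map (ratAct P : RatFun4 k →ₐ[k] RatFun4 k) ≤ projField k := by
  rw [projField, IntermediateField.adjoin_map, IntermediateField.adjoin_le_iff]
  rintro _ ⟨x, hx, rfl⟩
  rcases hx with rfl | rfl | rfl <;> exact ratAct_var_div_mem_projField P _ _

theorem map_ratAct_projField (P : GL (Fin 4) k) :
    (projField k).map (ratAct P : RatFun4 k →ₐ[k] RatFun4 k) = projField k := by
  refine le_antisymm (map_ratAct_projField_le P) fun x hx => ?_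
  refine ⟨ratAct P⁻¹ x, map_ratAct_projField_le P⁻¹ ⟨x, hx, rfl⟩, ?_⟩
  change (ratAct P * ratAct P⁻¹) x = x
  rw [← map_mul, mul_inv_cancel, map_one, AlgEquiv.one_apply]

theorem map_ratAct_fixedField (P : GL (Fin 4) k) (H : Subgroup (GL (Fin 4) k)) :
    (fixedField H).map (ratAct P : RatFun4 k →ₐ[k] RatFun4 k) =
      fixedField (H.map (MulAut.conj P).toMonoidHom) := by
  have hcomp : ∀ (a b : GL (Fin 4) k) (f : RatFun4 k), ratAct a (ratAct b f) = ratAct (a * b) f :=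
    fun a b f => by rw [map_mul]; rfl
  ext f
  rw [mem_fixedField]
  constructor
  · rintro ⟨y, hy, rfl⟩ _ ⟨h, hh, rfl⟩
    have hy' := (mem_fixedField H y).1 hy h hh
    change ratAct (P * h * P⁻¹) (ratAct P y) = ratAct P y
    rw [hcomp, inv_mul_cancel_right, ← hcomp, hy']
  · intro hf
    refine ⟨ratAct P⁻¹ f, (mem_fixedField H _).2 fun h hh => ?_, ?_⟩
    · have := hf _ ⟨h, hh, rfl⟩
      change ratAct (P * h * P⁻¹) f = f at this
      conv_rhs => rw [← this]
      rw [hcomp, hcomp]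
      congr 2
      group
    · change ratAct P (ratAct P⁻¹ f) = f
      rw [hcomp, mul_inv_cancel, map_one, AlgEquiv.one_apply]

/-- Rationality of both fixed fields only depends on the conjugacy class of the group: the
automorphism `ratAct P` carries the fixed field of `H` to that of `P H P⁻¹` and stabilizes the
field of the ratios of the variables. -/
theorem isRational_of_inClassOf {G H : Subgroup (GL (Fin 4) k)} (h : InClassOf G H)
    (hfix : IsPurelyGenerated (fixedField H)) (hproj : IsPurelyGenerated (projFixedField H)) :
    IsRational k (fixedField G) ∧ IsRational k (projFixedField G) := by
  obtain ⟨P, rfl⟩ := h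
  have h₁ := hfix.map (ratAct P : RatFun4 k →ₐ[k] RatFun4 k)
  have h₂ := hproj.map (ratAct P : RatFun4 k →ₐ[k] RatFun4 k)
  rw [projFixedField, IntermediateField.map_inf, map_ratAct_projField] at h₂
  rw [map_ratAct_fixedField] at h₁ h₂
  exact ⟨h₁.isRational, h₂.isRational⟩

theorem fixedField_generatedBy (S : Set (Matrix (Fin 4) (Fin 4) k)) {f : RatFun4 k} :
    f ∈ fixedField (generatedBy S) ↔
      ∀ g : GL (Fin 4) k, (g : Matrix (Fin 4) (Fin 4) k) ∈ S → ratAct g f = f := by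
  rw [mem_fixedField]
  refine ⟨fun h g hg => h g (Subgroup.subset_closure hg), fun h g hg => ?_⟩
  induction hg using Subgroup.closure_induction with
  | mem x hx => exact h x hx
  | one => rw [map_one, AlgEquiv.one_apply]
  | mul x y _ _ hx hy => rw [map_mul, AlgEquiv.mul_apply, hy, hx]
  | inv x _ hx =>
    rw [map_inv]
    exact (AlgEquiv.symm_apply_eq _).2 hx.symm

end

/-! ### Invariants of an axis with a perpendicular vector -/

/-- Conditions on a vector `(a, b, c)` that make the rational functions of `Frame` well defined.
In terms of `p = bc/a`, `q = ca/b`, `r = ab/c` they say that the denominators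
`n`, `u`, `v`, `m = u + v` and `l = u² - uv + v²` do not vanish. -/
structure IsGenericAxis {A : Type*} [CommRing A] (a b c : A) : Prop where
  a_ne : a ≠ 0
  b_ne : b ≠ 0
  c_ne : c ≠ 0
  n_ne : b ^ 4 * c ^ 4 + c ^ 4 * a ^ 4 + a ^ 4 * b ^ 4 -
    a ^ 2 * b ^ 2 * c ^ 2 * (a ^ 2 + b ^ 2 + c ^ 2) ≠ 0
  u_ne : a ^ 2 * b ^ 4 + b ^ 2 * c ^ 4 + c ^ 2 * a ^ 4 - 3 * a ^ 2 * b ^ 2 * c ^ 2 ≠ 0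
  v_ne : a ^ 4 * b ^ 2 + b ^ 4 * c ^ 2 + c ^ 4 * a ^ 2 - 3 * a ^ 2 * b ^ 2 * c ^ 2 ≠ 0
  m_ne : (b ^ 2 * c ^ 2 + c ^ 2 * a ^ 2 + a ^ 2 * b ^ 2) * (a ^ 2 + b ^ 2 + c ^ 2) -
    9 * a ^ 2 * b ^ 2 * c ^ 2 ≠ 0
  l_ne : (a ^ 2 + b ^ 2 + c ^ 2) ^ 2 - 3 * (b ^ 2 * c ^ 2 + c ^ 2 * a ^ 2 + a ^ 2 * b ^ 2) ≠ 0

/-- Genericity may be tested at a point of the shape `(s, s, 0)`. -/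
theorem IsGenericAxis.of_eval {A K : Type*} [CommRing A] [Field K] (ev : A →+* K) {a b c : A}
    {s : K} (h2 : (2 : K) ≠ 0) (hs : s ≠ 0) (ha : ev a = s) (hb : ev b = s) (hc : ev c = 0)
    (hc0 : c ≠ 0) : IsGenericAxis a b c := by
  have key : ∀ x : A, ev x ≠ 0 → x ≠ 0 := fun x hx h => hx (by rw [h, map_zero])
  refine ⟨key _ ?_, key _ ?_, hc0, key _ ?_, key _ ?_, key _ ?_, key _ ?_, key _ ?_⟩
  · rwa [ha]
  · rwa [hb]
  all_goals simp only [map_sub, map_add, map_mul, map_pow, map_ofNat, ha, hb, hc]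
  · convert pow_ne_zero 8 hs using 1; ring
  · convert pow_ne_zero 6 hs using 1; ring
  · convert pow_ne_zero 6 hs using 1; ring
  · convert mul_ne_zero h2 (pow_ne_zero 6 hs) using 1; ring
  · convert pow_ne_zero 4 hs using 1; ring

theorem IsGenericAxis.map {A E : Type*} [CommRing A] [CommRing E] {a b c : A} {ι : A →+* E}
    (hι : Function.Injective ι) (h : IsGenericAxis a b c) : IsGenericAxis (ι a) (ι b) (ι c) := by
  have key : ∀ x : A, x ≠ 0 → ι x ≠ 0 := fun x hx => (map_ne_zero_iff ι hι).2 hx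
  refine ⟨key _ h.a_ne, key _ h.b_ne, key _ h.c_ne, ?_, ?_, ?_, ?_, ?_⟩
  · simpa only [map_sub, map_add, map_mul, map_pow, map_ofNat] using key _ h.n_ne
  · simpa only [map_sub, map_add, map_mul, map_pow, map_ofNat] using key _ h.u_ne
  · simpa only [map_sub, map_add, map_mul, map_pow, map_ofNat] using key _ h.v_ne
  · simpa only [map_sub, map_add, map_mul, map_pow, map_ofNat] using key _ h.m_ne
  · simpa only [map_sub, map_add, map_mul, map_pow, map_ofNat] using key _ h.l_ne

theorem IsGenericAxis.div {E : Type*} [Field E] {a b c t : E} (ht : t ≠ 0)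
    (h : IsGenericAxis a b c) : IsGenericAxis (a / t) (b / t) (c / t) := by
  refine ⟨div_ne_zero h.a_ne ht, div_ne_zero h.b_ne ht, div_ne_zero h.c_ne ht, ?_, ?_, ?_, ?_, ?_⟩
  · convert div_ne_zero h.n_ne (pow_ne_zero 8 ht) using 1; field_simp
  · convert div_ne_zero h.u_ne (pow_ne_zero 6 ht) using 1; field_simp
  · convert div_ne_zero h.v_ne (pow_ne_zero 6 ht) using 1; field_simp
  · convert div_ne_zero h.m_ne (pow_ne_zero 6 ht) using 1; field_simp
  · convert div_ne_zero h.l_ne (pow_ne_zero 4 ht) using 1; field_simp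

section
variable {E : Type*} [Field E]

/-- A vector `(a, b, c)` of square norm `κ` (the axis) and a perpendicular vector `(d₁, d₂, d₃)` of
square norm `lam`. The alternating group on four letters acts on such pairs by even sign changes
and cyclic permutations of the coordinates. -/
structure Frame (E : Type*) [Field E] (κ lam : ℕ) where
  (a b c d₁ d₂ d₃ : E)
  norm_axis : a ^ 2 + b ^ 2 + c ^ 2 = κ
  orth : a * d₁ + b * d₂ + c * d₃ = 0
  norm_d : d₁ ^ 2 + d₂ ^ 2 + d₃ ^ 2 = lam
  κ_ne : (κ : E) ≠ 0
  lam_ne : (lam : E) ≠ 0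
  two_ne : (2 : E) ≠ 0
  generic : IsGenericAxis a b c

namespace Frame

variable {κ lam : ℕ} (F : Frame E κ lam)

/-- The vector `(e₁, e₂, e₃)` is the cross product of the axis with `(d₁, d₂, d₃)`. -/
def e₁ : E := F.b * F.d₃ - F.c * F.d₂
/-- The second coordinate of the cross product. -/
def e₂ : E := F.c * F.d₁ - F.a * F.d₃
/-- The third coordinate of the cross product. -/
def e₃ : E := F.a * F.d₂ - F.b * F.d₁

/-- The functions `p`, `q`, `r` are invariant under even sign changes and permuted cyclically; the
sum of their pairwise products is `κ`. -/
def p : E := F.b * F.c / F.a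
/-- The second of the three cyclically permuted functions. -/
def q : E := F.c * F.a / F.b
/-- The third of the three cyclically permuted functions. -/
def r : E := F.a * F.b / F.c

/-- The product of `(d₁, d₂, d₃)` with the vector `(1/a, 1/b, 1/c)` of inverses. -/
def f₁ : E := F.d₁ / F.a + F.d₂ / F.b + F.d₃ / F.c
/-- The product of `(e₁, e₂, e₃)` with the vector `(1/a, 1/b, 1/c)` of inverses. -/
def f₂ : E := F.e₁ / F.a + F.e₂ / F.b + F.e₃ / F.c

/-- The cyclic quadratic form in `p`, `q`, `r` that is the common denominator of `u` and `v`. -/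
def n : E := F.p ^ 2 + F.q ^ 2 + F.r ^ 2 - F.p * F.q - F.q * F.r - F.r * F.p
/-- With its mirror image `v`, a generator of the field of cyclic invariants of `p`, `q`, `r`, on
the quadric where the sum of the pairwise products is the constant `κ`. -/
def u : E := (F.p ^ 2 * F.q + F.q ^ 2 * F.r + F.r ^ 2 * F.p - 3 * F.p * F.q * F.r) / F.n
/-- The function obtained from `u` by exchanging `p` and `r`. -/
def v : E := (F.p * F.q ^ 2 + F.q * F.r ^ 2 + F.r * F.p ^ 2 - 3 * F.p * F.q * F.r) / F.n
/-- The norm form in `u` and `v`. -/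
def l : E := F.u ^ 2 - F.u * F.v + F.v ^ 2
/-- The norm of `f₁ + (√-κ / κ) f₂`. -/
def nf : E := F.f₁ ^ 2 + F.f₂ ^ 2 / κ

/-- With `ε = √-κ`, the functions `X` and `Y` are defined by
`X + ε Y = ((3l - κ) + 3ε (u - v)) / (u (f₁ + (ε / κ) f₂))`. This combination turns the relation
between `f₁`, `f₂`, `u`, `v` into the relation `Frame.quadric` of degree one in `t`. -/
def X : E := ((3 * F.l - κ) * F.f₁ + 3 * (F.u - F.v) * F.f₂) / (F.u * F.nf)
/-- The component along `√-κ` of the combination that defines `X`. -/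
def Y : E := (3 * (F.u - F.v) * F.f₁ - (3 * F.l - κ) * F.f₂ / κ) / (F.u * F.nf)
/-- The third generator of the field of invariants. -/
def w : E := F.l / F.u
/-- The ratio `v / u`, which by `Frame.quadric` is a polynomial in `X`, `Y`, `w`. -/
def t : E := F.v / F.u

theorem p_mul_q : F.p * F.q = F.c ^ 2 := by
  have := F.generic.a_ne; have := F.generic.b_ne
  simp only [p, q]; field_simp

theorem q_mul_r : F.q * F.r = F.a ^ 2 := by
  have := F.generic.c_ne; have := F.generic.b_ne
  simp only [r, q]; field_simp

theorem r_mul_p : F.r * F.p = F.b ^ 2 := by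
  have := F.generic.a_ne; have := F.generic.c_ne
  simp only [p, r]; field_simp

theorem p_mul_q_mul_r : F.p * F.q * F.r = F.a * F.b * F.c := by
  have := F.generic.a_ne; have := F.generic.c_ne; have := F.generic.b_ne
  simp only [p, q, r]; field_simp

theorem s₂_eq : F.p * F.q + F.q * F.r + F.r * F.p = κ := by
  rw [p_mul_q, q_mul_r, r_mul_p, ← F.norm_axis]; ring

theorem n_ne : F.n ≠ 0 := by
  have h1 := F.generic.a_ne; have h2 := F.generic.b_ne; have h3 := F.generic.c_ne
  intro h
  apply F.generic.n_ne
  have : F.n * (F.a * F.b * F.c) ^ 2 = 0 := by rw [h, zero_mul]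
  rw [← this]; simp only [n, p, q, r]; field_simp
  ring

theorem u_mul_n : F.u * F.n = F.p ^ 2 * F.q + F.q ^ 2 * F.r + F.r ^ 2 * F.p - 3 * F.p * F.q * F.r :=
  div_mul_cancel₀ _ F.n_ne

theorem v_mul_n : F.v * F.n = F.p * F.q ^ 2 + F.q * F.r ^ 2 + F.r * F.p ^ 2 - 3 * F.p * F.q * F.r :=
  div_mul_cancel₀ _ F.n_ne

theorem u_ne : F.u ≠ 0 := by
  have h1 := F.generic.a_ne; have h2 := F.generic.b_ne; have h3 := F.generic.c_ne
  intro h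
  apply F.generic.u_ne
  have : F.u * F.n * (F.a * F.b * F.c) = 0 := by rw [h, zero_mul, zero_mul]
  rw [← this, u_mul_n]; simp only [p, q, r]; field_simp
  ring

theorem v_ne : F.v ≠ 0 := by
  have h1 := F.generic.a_ne; have h2 := F.generic.b_ne; have h3 := F.generic.c_ne
  intro h
  apply F.generic.v_ne
  have : F.v * F.n * (F.a * F.b * F.c) = 0 := by rw [h, zero_mul, zero_mul]
  rw [← this, v_mul_n]; simp only [p, q, r]; field_simp
  ring

theorem m_mul_n : (F.u + F.v) * F.n =
    (F.p + F.q + F.r) * (F.p * F.q + F.q * F.r + F.r * F.p) - 9 * (F.p * F.q * F.r) := by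
  linear_combination F.u_mul_n + F.v_mul_n

theorem m_ne : F.u + F.v ≠ 0 := by
  have h1 := F.generic.a_ne; have h2 := F.generic.b_ne; have h3 := F.generic.c_ne
  intro h
  apply F.generic.m_ne
  have : (F.u + F.v) * F.n * (F.a * F.b * F.c) = 0 := by rw [h, zero_mul, zero_mul]
  rw [← this, m_mul_n]; simp only [p, q, r]; field_simp
  ring

theorem l_mul_n : F.l * F.n = (F.p * F.q + F.q * F.r + F.r * F.p) ^ 2 -
    3 * (F.p + F.q + F.r) * (F.p * F.q * F.r) := by
  apply mul_right_cancel₀ F.n_ne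
  have : F.l * F.n * F.n = (F.u * F.n) ^ 2 - (F.u * F.n) * (F.v * F.n) + (F.v * F.n) ^ 2 := by
    simp only [l]; ring
  rw [this, u_mul_n, v_mul_n]; simp only [n]; ring

theorem l_ne : F.l ≠ 0 := by
  intro h
  apply F.generic.l_ne
  have : F.l * F.n = 0 := by rw [h, zero_mul]
  rw [← this, l_mul_n, ← F.p_mul_q, ← F.q_mul_r, ← F.r_mul_p]; ring

theorem s₁_mul : (F.p + F.q + F.r) * (F.u + F.v) = κ + 3 * F.l := by
  apply mul_right_cancel₀ F.n_ne
  rw [← F.s₂_eq]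
  have e : (F.p * F.q + F.q * F.r + F.r * F.p + 3 * F.l) * F.n
    = (F.p * F.q + F.q * F.r + F.r * F.p) * F.n + 3 * (F.l * F.n) := by ring
  rw [e, l_mul_n, mul_assoc, m_mul_n]; simp only [n]; ring

theorem s₃_eq : F.p * F.q * F.r = (F.p + F.q + F.r) * (F.u * F.v) - (F.u ^ 3 + F.v ^ 3) := by
  have h3 : F.n ^ 3 ≠ 0 := pow_ne_zero 3 F.n_ne
  apply mul_right_cancel₀ h3
  have e : ((F.p + F.q + F.r) * (F.u * F.v) - (F.u ^ 3 + F.v ^ 3)) * F.n ^ 3 =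
    (F.p + F.q + F.r) * F.n * ((F.u * F.n) * (F.v * F.n)) -
      ((F.u * F.n) ^ 3 + (F.v * F.n) ^ 3) := by
    ring
  rw [e, u_mul_n, v_mul_n]; simp only [n]; ring

theorem s₃_mul : F.p * F.q * F.r * (F.u + F.v) = κ * (F.u * F.v) - F.l ^ 2 := by
  rw [s₃_eq, sub_mul, mul_right_comm, s₁_mul]; simp only [l]; ring

/-- The relation tying `(f₁, f₂)` to the cyclic invariants. Both sides compute, up to a factor, the
square norm of the component of `(1/a, 1/b, 1/c)` perpendicular to the axis. -/
theorem nf_eq : F.nf * (κ * (F.p * F.q * F.r)) =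
    lam * (κ * (F.p + F.q + F.r) - 9 * (F.p * F.q * F.r)) := by
  have ha := F.generic.a_ne
  have hb := F.generic.b_ne
  have hc := F.generic.c_ne
  have hκ := F.κ_ne
  -- `(g·d)²|x|² + det(g, x, d)² = |d|²(|g|²|x|² - (g·x)²)` for `d ⟂ x`, applied to the axis
  -- `x = (a, b, c)` and `g = (1/a, 1/b, 1/c)`, for which `g·x = 3`.
  have gram : ∀ g₁ g₂ g₃ : E, κ * (g₁ * F.d₁ + g₂ * F.d₂ + g₃ * F.d₃) ^ 2 +
      (g₁ * F.e₁ + g₂ * F.e₂ + g₃ * F.e₃) ^ 2 =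
      lam * (κ * (g₁ ^ 2 + g₂ ^ 2 + g₃ ^ 2) - (g₁ * F.a + g₂ * F.b + g₃ * F.c) ^ 2) := by
    intro g₁ g₂ g₃
    rw [← F.norm_axis, ← F.norm_d]
    simp only [e₁, e₂, e₃]
    linear_combination (2 * (g₁ * F.a + g₂ * F.b + g₃ * F.c) * (g₁ * F.d₁ + g₂ * F.d₂ + g₃ * F.d₃)
      - (g₁ ^ 2 + g₂ ^ 2 + g₃ ^ 2) * (F.a * F.d₁ + F.b * F.d₂ + F.c * F.d₃)) * F.orth
  have h := gram F.a⁻¹ F.b⁻¹ F.c⁻¹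
  have h1 : κ * F.nf = κ * F.f₁ ^ 2 + F.f₂ ^ 2 := by simp only [nf]; field_simp
  have h2 : κ * F.f₁ ^ 2 + F.f₂ ^ 2 = lam * (κ * (F.a⁻¹ ^ 2 + F.b⁻¹ ^ 2 + F.c⁻¹ ^ 2) - 9) := by
    rw [show (9 : E) = (F.a⁻¹ * F.a + F.b⁻¹ * F.b + F.c⁻¹ * F.c) ^ 2 by
      rw [inv_mul_cancel₀ ha, inv_mul_cancel₀ hb, inv_mul_cancel₀ hc]; norm_num, ← h]
    simp only [f₁, f₂]; ring
  rw [← mul_assoc, mul_comm F.nf, h1, h2, p_mul_q_mul_r]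
  simp only [p, q, r]
  field_simp

/-- The second factor on the left is the numerator of `nf`, by `nf_eq`, and the right side is the
norm of `(3l - κ) + 3 √-κ (u - v)`: dividing that element by `f₁ + (√-κ / κ) f₂` leaves a
simple norm. -/
theorem disc_eq : (F.u + F.v) * (κ * (F.p + F.q + F.r) - 9 * (F.p * F.q * F.r)) =
    (3 * F.l - κ) ^ 2 + κ * (3 * (F.u - F.v)) ^ 2 := by
  have h1 := F.s₁_mul
  have h2 := F.s₃_mul
  have h3 : F.l = F.u ^ 2 - F.u * F.v + F.v ^ 2 := rfl
  linear_combination κ * h1 - 9 * h2 + 9 * κ * h3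

theorem s_ne : (κ : E) * (F.p + F.q + F.r) - 9 * (F.p * F.q * F.r) ≠ 0 := by
  have h := mul_ne_zero F.m_ne F.n_ne
  rw [m_mul_n, s₂_eq] at h
  rwa [mul_comm (κ : E)]

theorem disc_ne : (3 * F.l - κ) ^ 2 + κ * (3 * (F.u - F.v)) ^ 2 ≠ 0 :=
  F.disc_eq ▸ mul_ne_zero F.m_ne F.s_ne

theorem nf_ne : F.nf ≠ 0 := by
  have := F.nf_eq ▸ mul_ne_zero F.lam_ne F.s_ne
  exact left_ne_zero_of_mul this

/-- Norms in the definition of `X + √-κ Y` as a quotient. -/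
theorem normXY : F.X ^ 2 + κ * F.Y ^ 2 =
    ((3 * F.l - κ) ^ 2 + κ * (3 * (F.u - F.v)) ^ 2) / (F.u ^ 2 * F.nf) := by
  have h0 := F.κ_ne
  have h1 := F.u_ne
  have h2 := F.nf_ne
  have h3 : F.f₁ ^ 2 = F.nf - F.f₂ ^ 2 / κ := by simp only [nf]; ring
  simp only [X, Y]
  field_simp
  have h4 : κ * F.f₁ ^ 2 = κ * F.nf - F.f₂ ^ 2 := by rw [h3]; field_simp
  linear_combination ((3 * F.l - κ) ^ 2 + κ * (3 * (F.u - F.v)) ^ 2) * h4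

theorem normXY_ne : F.X ^ 2 + κ * F.Y ^ 2 ≠ 0 := by
  rw [normXY]
  exact div_ne_zero F.disc_ne (mul_ne_zero (pow_ne_zero 2 F.u_ne) F.nf_ne)

/-- The key relation: `t` is a diagonal quadratic form in `X`, `Y`, `w`. -/
theorem quadric : lam * (F.X ^ 2 + κ * F.Y ^ 2) + κ * F.w ^ 2 = κ ^ 2 * F.t := by
  have h1 := F.u_ne
  have h2 := F.nf_ne
  rw [normXY, ← disc_eq]
  simp only [w, t]
  have h3 := F.s₃_mul
  have h4 := F.nf_eq
  field_simp
  linear_combination (-(F.u + F.v)) * h4 + F.nf * κ * h3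

/-- Together with `Frame.quadric` this recovers `u` from `X`, `Y`, `w`. -/
theorem w_eq : F.w = F.u * (1 - F.t + F.t ^ 2) := by
  have := F.u_ne
  simp only [w, t, l]; field_simp

theorem t_ne : F.t ≠ 0 := div_ne_zero F.v_ne F.u_ne
theorem w_ne : F.w ≠ 0 := div_ne_zero F.l_ne F.u_ne

theorem v_eq : F.v = F.t * F.u := (div_mul_cancel₀ _ F.u_ne).symm

theorem f₁_eq : F.f₁ = ((3 * F.l - κ) * F.X + κ * (3 * (F.u - F.v)) * F.Y) /
    (F.u * (F.X ^ 2 + κ * F.Y ^ 2)) := by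
  have h0 := F.κ_ne
  have h1 := F.u_ne
  have h2 := F.nf_ne
  have h3 := F.disc_ne
  rw [normXY]
  simp only [X, Y]
  generalize 3 * F.l - (κ : E) = A at *
  generalize 3 * (F.u - F.v) = B at *
  have h4 : A ^ 2 + B ^ 2 * κ ≠ 0 := by rwa [mul_comm (B ^ 2)]
  field_simp
  ring

theorem f₂_eq : F.f₂ = κ * (3 * (F.u - F.v) * F.X - (3 * F.l - κ) * F.Y) /
    (F.u * (F.X ^ 2 + κ * F.Y ^ 2)) := by
  have h0 := F.κ_ne
  have h1 := F.u_ne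
  have h2 := F.nf_ne
  have h3 := F.disc_ne
  rw [normXY]
  simp only [X, Y]
  generalize 3 * F.l - (κ : E) = A at *
  generalize 3 * (F.u - F.v) = B at *
  field_simp
  ring

/-! ### Recovering the axis from the invariants -/

section Mem
variable {k : Type*} [Field k] [Algebra k E] {M : IntermediateField k E}

theorem t_mem (hX : F.X ∈ M) (hY : F.Y ∈ M) (hw : F.w ∈ M) : F.t ∈ M := by
  have h := F.quadric
  have hκ := F.κ_ne
  have : F.t = (lam * (F.X ^ 2 + κ * F.Y ^ 2) + κ * F.w ^ 2) / κ ^ 2 := by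
    rw [h]; field_simp
  rw [this]
  have := natCast_mem M κ
  have := natCast_mem M lam
  apply_rules [add_mem, mul_mem, div_mem, pow_mem]

theorem u_mem (hX : F.X ∈ M) (hY : F.Y ∈ M) (hw : F.w ∈ M) : F.u ∈ M := by
  have ht := F.t_mem hX hY hw
  have h : F.u = F.w / (1 - F.t + F.t ^ 2) := by
    have hne := F.w_ne
    rw [w_eq] at hne
    rw [w_eq, mul_div_cancel_right₀ _ (right_ne_zero_of_mul hne)]
  rw [h]
  exact div_mem hw (add_mem (sub_mem (one_mem _) ht) (pow_mem ht 2))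

theorem v_mem (hX : F.X ∈ M) (hY : F.Y ∈ M) (hw : F.w ∈ M) : F.v ∈ M := by
  rw [v_eq]
  exact mul_mem (F.t_mem hX hY hw) (F.u_mem hX hY hw)

theorem l_mem (hu : F.u ∈ M) (hv : F.v ∈ M) : F.l ∈ M := by
  simp only [l]
  apply_rules [add_mem, sub_mem, mul_mem, pow_mem]

theorem f₁_mem (hX : F.X ∈ M) (hY : F.Y ∈ M) (hw : F.w ∈ M) : F.f₁ ∈ M := by
  have hu := F.u_mem hX hY hw
  have hv := F.v_mem hX hY hw
  have hl := F.l_mem hu hv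
  have := natCast_mem M κ
  have := natCast_mem M 3
  rw [f₁_eq]
  apply_rules [add_mem, sub_mem, mul_mem, div_mem, pow_mem]

theorem f₂_mem (hX : F.X ∈ M) (hY : F.Y ∈ M) (hw : F.w ∈ M) : F.f₂ ∈ M := by
  have hu := F.u_mem hX hY hw
  have hv := F.v_mem hX hY hw
  have hl := F.l_mem hu hv
  have := natCast_mem M κ
  have := natCast_mem M 3
  rw [f₂_eq]
  apply_rules [add_mem, sub_mem, mul_mem, div_mem, pow_mem]

theorem s₁_mem (hX : F.X ∈ M) (hY : F.Y ∈ M) (hw : F.w ∈ M) : F.p + F.q + F.r ∈ M := by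
  have hu := F.u_mem hX hY hw
  have hv := F.v_mem hX hY hw
  have hl := F.l_mem hu hv
  have := natCast_mem M κ
  have := natCast_mem M 3
  rw [eq_div_of_mul_eq F.m_ne F.s₁_mul]
  apply_rules [add_mem, sub_mem, mul_mem, div_mem, pow_mem]

theorem s₃_mem (hX : F.X ∈ M) (hY : F.Y ∈ M) (hw : F.w ∈ M) : F.p * F.q * F.r ∈ M := by
  have hu := F.u_mem hX hY hw
  have hv := F.v_mem hX hY hw
  have := F.s₁_mem hX hY hw
  rw [s₃_eq]
  apply_rules [sub_mem, add_mem, mul_mem, pow_mem]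

/-- The differences of the roots `p`, `q`, `r` of a cubic over `k(X, Y, w)` lie in
`k(X, Y, w)(p)`, as `n (u - v) = (p - q) (q - r) (p - r)`. -/
theorem q_mem_and_r_mem (hX : F.X ∈ M) (hY : F.Y ∈ M) (hw : F.w ∈ M) (hp : F.p ∈ M)
    (hpq : F.p ≠ F.q) (hpr : F.p ≠ F.r) : F.q ∈ M ∧ F.r ∈ M := by
  have hu := F.u_mem hX hY hw
  have hv := F.v_mem hX hY hw
  have hs := F.s₁_mem hX hY hw
  have h2 := F.two_ne
  have := natCast_mem M κ
  have := natCast_mem M 3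
  have := natCast_mem M 2
  have hprod : (F.p - F.q) * (F.p - F.r) =
      ((3 : ℕ) : E) * F.p ^ 2 - ((2 : ℕ) : E) * (F.p + F.q + F.r) * F.p + κ := by
    rw [← F.s₂_eq]; push_cast; ring
  have hn : F.n = (F.p + F.q + F.r) ^ 2 - ((3 : ℕ) : E) * κ := by
    rw [← F.s₂_eq]; simp only [n]; push_cast; ring
  have hdiff : F.q - F.r = (F.u - F.v) * F.n / ((F.p - F.q) * (F.p - F.r)) := by
    rw [eq_div_iff (mul_ne_zero (sub_ne_zero.2 hpq) (sub_ne_zero.2 hpr)),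
      sub_mul F.u, u_mul_n, v_mul_n]
    ring
  have hmem : F.q - F.r ∈ M := by
    rw [hdiff, hprod, hn]
    apply_rules [sub_mem, add_mem, mul_mem, div_mem, pow_mem]
  have hq : F.q = ((F.p + F.q + F.r) - F.p + (F.q - F.r)) / ((2 : ℕ) : E) := by
    push_cast; field_simp; ring
  have hr : F.r = ((F.p + F.q + F.r) - F.p - (F.q - F.r)) / ((2 : ℕ) : E) := by
    push_cast; field_simp; ring
  constructor
  · rw [hq]
    apply_rules [sub_mem, add_mem, div_mem]
  · rw [hr]
    apply_rules [sub_mem, add_mem, div_mem]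

/-- A vector `d` orthogonal to the axis `x = (a, b, c)` is determined by `g·d = f₁` and
`det(g, x, d) = f₂`, where `g = (1/a, 1/b, 1/c)`. -/
theorem d_mem (ha : F.a ∈ M) (hb : F.b ∈ M) (hc : F.c ∈ M) (h₁ : F.f₁ ∈ M) (h₂ : F.f₂ ∈ M) :
    F.d₁ ∈ M ∧ F.d₂ ∈ M ∧ F.d₃ ∈ M := by
  have ha0 := F.generic.a_ne
  have hb0 := F.generic.b_ne
  have hc0 := F.generic.c_ne
  have := natCast_mem M κ
  set D : E := κ * (F.a⁻¹ ^ 2 + F.b⁻¹ ^ 2 + F.c⁻¹ ^ 2) - 9 with hD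
  have hD0 : D ≠ 0 := by
    have h := F.s_ne
    rw [p_mul_q_mul_r] at h
    intro h0
    apply h
    have : D * (F.a * F.b * F.c) = 0 := by rw [h0, zero_mul]
    rw [← this, hD]
    simp only [p, q, r]
    field_simp
  have solve : ∀ x₁ x₂ x₃ d₁ d₂ d₃ g₁ g₂ g₃ : E, x₁ ^ 2 + x₂ ^ 2 + x₃ ^ 2 = κ →
      x₁ * d₁ + x₂ * d₂ + x₃ * d₃ = 0 → g₁ * x₁ + g₂ * x₂ + g₃ * x₃ = 3 →
      (κ * (g₁ ^ 2 + g₂ ^ 2 + g₃ ^ 2) - 9) * d₁ =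
        (g₁ * d₁ + g₂ * d₂ + g₃ * d₃) * (κ * g₁ - 3 * x₁) +
        (g₁ * (x₂ * d₃ - x₃ * d₂) + g₂ * (x₃ * d₁ - x₁ * d₃) + g₃ * (x₁ * d₂ - x₂ * d₁)) *
          (g₂ * x₃ - g₃ * x₂) := by
    intro x₁ x₂ x₃ d₁ d₂ d₃ g₁ g₂ g₃ hx hd hg
    rw [← hx, show (9 : E) = 3 ^ 2 by norm_num, ← hg]
    linear_combination
      ((g₁ ^ 2 + g₂ ^ 2 + g₃ ^ 2) * x₁ - (g₁ * x₁ + g₂ * x₂ + g₃ * x₃) * g₁) * hd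
  have hnorm := F.norm_axis
  have horth := F.orth
  have h3 : F.a⁻¹ * F.a + F.b⁻¹ * F.b + F.c⁻¹ * F.c = 3 := by
    rw [inv_mul_cancel₀ ha0, inv_mul_cancel₀ hb0, inv_mul_cancel₀ hc0]; norm_num
  have hf₁ : F.f₁ = F.a⁻¹ * F.d₁ + F.b⁻¹ * F.d₂ + F.c⁻¹ * F.d₃ := by simp only [f₁]; ring
  have hf₂ : F.f₂ = F.a⁻¹ * F.e₁ + F.b⁻¹ * F.e₂ + F.c⁻¹ * F.e₃ := by simp only [f₂]; ring
  have e1 : F.d₁ = (F.f₁ * (κ * F.a⁻¹ - 3 * F.a) + F.f₂ * (F.b⁻¹ * F.c - F.c⁻¹ * F.b)) / D := by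
    rw [eq_div_iff hD0, mul_comm, hf₁, hf₂]
    exact solve F.a F.b F.c F.d₁ F.d₂ F.d₃ _ _ _ hnorm horth h3
  have e2 : F.d₂ = (F.f₁ * (κ * F.b⁻¹ - 3 * F.b) + F.f₂ * (F.c⁻¹ * F.a - F.a⁻¹ * F.c)) / D := by
    rw [eq_div_iff hD0, mul_comm, hf₁, hf₂]
    have := solve F.b F.c F.a F.d₂ F.d₃ F.d₁ F.b⁻¹ F.c⁻¹ F.a⁻¹ (by rw [← hnorm]; ring)
      (by rw [← horth]; ring) (by rw [← h3]; ring)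
    simp only [e₁, e₂, e₃, hD]
    linear_combination this
  have e3 : F.d₃ = (F.f₁ * (κ * F.c⁻¹ - 3 * F.c) + F.f₂ * (F.a⁻¹ * F.b - F.b⁻¹ * F.a)) / D := by
    rw [eq_div_iff hD0, mul_comm, hf₁, hf₂]
    have := solve F.c F.a F.b F.d₃ F.d₁ F.d₂ F.c⁻¹ F.a⁻¹ F.b⁻¹ (by rw [← hnorm]; ring)
      (by rw [← horth]; ring) (by rw [← h3]; ring)
    simp only [e₁, e₂, e₃, hD]
    linear_combination this
  have := natCast_mem M 3
  have := natCast_mem M 9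
  have hDM : D ∈ M := by
    apply_rules [sub_mem, add_mem, mul_mem, div_mem, pow_mem, inv_mem]
  refine ⟨?_, ?_, ?_⟩
  · rw [e1]; apply_rules [sub_mem, add_mem, mul_mem, div_mem, pow_mem, inv_mem]
  · rw [e2]; apply_rules [sub_mem, add_mem, mul_mem, div_mem, pow_mem, inv_mem]
  · rw [e3]; apply_rules [sub_mem, add_mem, mul_mem, div_mem, pow_mem, inv_mem]

end Mem

/-! ### The invariants of even sign changes and cyclic permutations -/

section Descent
variable {k : Type*} [Field k] [Algebra k E]

/-- The functions `X`, `Y`, `w` are invariant under cyclic permutations. -/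
theorem map_cycle {g : E ≃ₐ[k] E} (ha : g F.a = F.c) (hb : g F.b = F.a) (hc : g F.c = F.b)
    (hd₁ : g F.d₁ = F.d₃) (hd₂ : g F.d₂ = F.d₁) (hd₃ : g F.d₃ = F.d₂) :
    (g F.p = F.r ∧ g F.q = F.p ∧ g F.r = F.q) ∧ g F.X = F.X ∧ g F.Y = F.Y ∧ g F.w = F.w := by
  have hp : g F.p = F.r := by simp only [p, r, map_div₀, map_mul, ha, hb, hc]
  have hq : g F.q = F.p := by simp only [p, q, map_div₀, map_mul, ha, hb, hc]
  have hr : g F.r = F.q := by simp only [q, r, map_div₀, map_mul, ha, hb, hc]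
  have hn : g F.n = F.n := by
    simp only [n, map_sub, map_add, map_mul, map_pow, hp, hq, hr]; ring
  have hu : g F.u = F.u := by
    simp only [u, map_div₀, map_sub, map_add, map_mul, map_pow, hp, hq, hr, hn, map_ofNat]; ring
  have hv : g F.v = F.v := by
    simp only [v, map_div₀, map_sub, map_add, map_mul, map_pow, hp, hq, hr, hn, map_ofNat]; ring
  have hl : g F.l = F.l := by
    simp only [l, map_sub, map_add, map_mul, map_pow, hu, hv]
  have hf₁ : g F.f₁ = F.f₁ := by
    simp only [f₁, map_add, map_div₀, ha, hb, hc, hd₁, hd₂, hd₃]; ring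
  have hf₂ : g F.f₂ = F.f₂ := by
    simp only [f₂, e₁, e₂, e₃, map_add, map_sub, map_mul, map_div₀, ha, hb, hc, hd₁, hd₂, hd₃]; ring
  have hnf : g F.nf = F.nf := by
    simp only [nf, map_add, map_div₀, map_pow, map_natCast, hf₁, hf₂]
  refine ⟨⟨hp, hq, hr⟩, ?_, ?_, ?_⟩
  · simp only [X, map_div₀, map_sub, map_add, map_mul, map_ofNat, map_natCast, hl, hu, hv, hf₁,
      hf₂, hnf]
  · simp only [Y, map_div₀, map_sub, map_mul, map_ofNat, map_natCast, hl, hu, hv, hf₁, hf₂, hnf]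
  · simp only [w, map_div₀, hl, hu]

/-- Even sign changes fix `p`, `q`, `r`, `f₁`, `f₂`. -/
theorem map_signs {g : E ≃ₐ[k] E} {ε₁ ε₂ ε₃ : E} (hε : ε₁ * ε₂ * ε₃ = 1)
    (h₁ : ε₁ ^ 2 = 1) (h₂ : ε₂ ^ 2 = 1) (h₃ : ε₃ ^ 2 = 1)
    (ha : g F.a = ε₁ * F.a) (hb : g F.b = ε₂ * F.b) (hc : g F.c = ε₃ * F.c)
    (hd₁ : g F.d₁ = ε₁ * F.d₁) (hd₂ : g F.d₂ = ε₂ * F.d₂) (hd₃ : g F.d₃ = ε₃ * F.d₃) :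
    g F.p = F.p ∧ g F.q = F.q ∧ g F.r = F.r ∧ g F.f₁ = F.f₁ ∧ g F.f₂ = F.f₂ := by
  have z₁ : ε₁ ≠ 0 := by rintro rfl; norm_num at h₁
  have z₂ : ε₂ ≠ 0 := by rintro rfl; norm_num at h₂
  have z₃ : ε₃ ≠ 0 := by rintro rfl; norm_num at h₃
  have k₁ : ε₂ * ε₃ = ε₁ := by linear_combination ε₁ * hε - ε₂ * ε₃ * h₁
  have k₂ : ε₃ * ε₁ = ε₂ := by linear_combination ε₂ * hε - ε₃ * ε₁ * h₂
  have k₃ : ε₁ * ε₂ = ε₃ := by linear_combination ε₃ * hε - ε₁ * ε₂ * h₃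
  have he₁ : g F.e₁ = ε₁ * F.e₁ := by
    simp only [e₁, map_sub, map_mul, hb, hc, hd₂, hd₃]; rw [← k₁]; ring
  have he₂ : g F.e₂ = ε₂ * F.e₂ := by
    simp only [e₂, map_sub, map_mul, ha, hc, hd₁, hd₃]; rw [← k₂]; ring
  have he₃ : g F.e₃ = ε₃ * F.e₃ := by
    simp only [e₃, map_sub, map_mul, ha, hb, hd₁, hd₂]; rw [← k₃]; ring
  refine ⟨?_, ?_, ?_, ?_, ?_⟩
  · simp only [p, map_div₀, map_mul, ha, hb, hc]
    rw [mul_mul_mul_comm, k₁, mul_div_mul_left _ _ z₁]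
  · simp only [q, map_div₀, map_mul, ha, hb, hc]
    rw [mul_mul_mul_comm, k₂, mul_div_mul_left _ _ z₂]
  · simp only [r, map_div₀, map_mul, ha, hb, hc]
    rw [mul_mul_mul_comm, k₃, mul_div_mul_left _ _ z₃]
  · simp only [f₁, map_add, map_div₀, ha, hb, hc, hd₁, hd₂, hd₃]
    rw [mul_div_mul_left _ _ z₁, mul_div_mul_left _ _ z₂, mul_div_mul_left _ _ z₃]
  · simp only [f₂, map_add, map_div₀, ha, hb, hc, he₁, he₂, he₃]
    rw [mul_div_mul_left _ _ z₁, mul_div_mul_left _ _ z₂, mul_div_mul_left _ _ z₃]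

theorem p_ne_q {g : E ≃ₐ[k] E} (hp : g F.p = F.r) (hq : g F.q = F.p) (hr : g F.r = F.q) :
    F.p ≠ F.q := by
  intro h
  have h1 : F.r = F.p := hp.symm.trans ((congrArg g h).trans hq)
  have h2 : F.q = F.r := hr.symm.trans ((congrArg g h1).trans hp)
  apply F.n_ne
  simp only [n, ← h2, h]; ring

theorem p_ne_r {g : E ≃ₐ[k] E} (hp : g F.p = F.r) (hq : g F.q = F.p) (hr : g F.r = F.q) :
    F.p ≠ F.r := by
  intro h
  apply F.p_ne_q hp hq hr
  exact h.trans (by rw [← hp, h, hr])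

/-- The invariants of the even sign changes `g₁`, `g₂` and the cyclic permutation `g₃` are generated
by `X`, `Y`, `w`. The tower climbs from `k(X, Y, w)` by `p`, a root of the cubic with roots
`p`, `q`, `r`, then by `a` and `b`, whose squares are `qr` and `rp`. The set `B` of constants
allows the same tower to be used over a larger base. -/
theorem descent {Γ : Set (E ≃ₐ[k] E)} {B : Set E} {g₁ g₂ g₃ : E ≃ₐ[k] E}
    (h₁ : g₁ ∈ Γ) (h₂ : g₂ ∈ Γ) (h₃ : g₃ ∈ Γ) (hB : ∀ g ∈ Γ, ∀ x ∈ B, g x = x)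
    (ha₁ : g₁ F.a = F.a) (hb₁ : g₁ F.b = -F.b) (hc₁ : g₁ F.c = -F.c)
    (hd₁₁ : g₁ F.d₁ = F.d₁) (hd₂₁ : g₁ F.d₂ = -F.d₂) (hd₃₁ : g₁ F.d₃ = -F.d₃)
    (ha₂ : g₂ F.a = -F.a) (hb₂ : g₂ F.b = F.b) (hc₂ : g₂ F.c = -F.c)
    (hd₁₂ : g₂ F.d₁ = -F.d₁) (hd₂₂ : g₂ F.d₂ = F.d₂) (hd₃₂ : g₂ F.d₃ = -F.d₃)
    (ha₃ : g₃ F.a = F.c) (hb₃ : g₃ F.b = F.a) (hc₃ : g₃ F.c = F.b)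
    (hd₁₃ : g₃ F.d₁ = F.d₃) (hd₂₃ : g₃ F.d₂ = F.d₁) (hd₃₃ : g₃ F.d₃ = F.d₂) :
    Descent Γ (IntermediateField.adjoin k ({F.a, F.b, F.c, F.d₁, F.d₂, F.d₃} ∪ B))
      (IntermediateField.adjoin k ({F.X, F.Y, F.w} ∪ B)) := by
  have h2 := F.two_ne
  obtain ⟨⟨hp, hq, hr⟩, hX, hY, hw⟩ := F.map_cycle ha₃ hb₃ hc₃ hd₁₃ hd₂₃ hd₃₃
  obtain ⟨hp₁, hq₁, hr₁, hf₁₁, hf₂₁⟩ := F.map_signs (g := g₁) (ε₁ := 1) (ε₂ := -1) (ε₃ := -1)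
    (by norm_num) (by norm_num) (by norm_num) (by norm_num) (by simpa) (by simpa) (by simpa)
    (by simpa) (by simpa) (by simpa)
  obtain ⟨hp₂, hq₂, hr₂, hf₁₂, hf₂₂⟩ := F.map_signs (g := g₂) (ε₁ := -1) (ε₂ := 1) (ε₃ := -1)
    (by norm_num) (by norm_num) (by norm_num) (by norm_num) (by simpa) (by simpa) (by simpa)
    (by simpa) (by simpa) (by simpa)
  have hpq := F.p_ne_q hp hq hr
  have hpr := F.p_ne_r hp hq hr
  have neg_ne : ∀ x : E, x ≠ 0 → -x ≠ x := fun x hx h => by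
    apply mul_ne_zero h2 hx
    linear_combination -h
  -- the field generated by the invariants of the four-group
  set S : Set E := {F.p, F.q, F.r, F.f₁, F.f₂} ∪ B with hS
  have step₃ : Descent Γ (IntermediateField.adjoin k S)
      (IntermediateField.adjoin k ({F.X, F.Y, F.w} ∪ B)) := by
    set M := IntermediateField.adjoin k ({F.X, F.Y, F.w} ∪ B) with hM
    have hXM : F.X ∈ M := IntermediateField.subset_adjoin _ _ (by simp)
    have hYM : F.Y ∈ M := IntermediateField.subset_adjoin _ _ (by simp)
    have hwM : F.w ∈ M := IntermediateField.subset_adjoin _ _ (by simp)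
    refine (Descent.of_cubic (θ := F.p) (s := -(F.p + F.q + F.r)) (t := κ)
      (n := -(F.p * F.q * F.r)) (g := g₃) h₃ ?_ (neg_mem (F.s₁_mem hXM hYM hwM)) (natCast_mem _ _)
      (neg_mem (F.s₃_mem hXM hYM hwM)) ?_ ?_).mono subset_rfl ?_
    · rintro x ((rfl | rfl | rfl) | hx)
      exacts [hX, hY, hw, hB _ h₃ _ hx]
    · rw [← F.s₂_eq]; ring
    · rw [hp]; exact hpr.symm
    · rw [IntermediateField.adjoin_le_iff]
      have hle : M ≤ M ⊔ IntermediateField.adjoin k {F.p} := le_sup_left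
      have hpM : F.p ∈ M ⊔ IntermediateField.adjoin k {F.p} :=
        (le_sup_right : IntermediateField.adjoin k {F.p} ≤ _)
          (IntermediateField.mem_adjoin_simple_self k F.p)
      have := F.q_mem_and_r_mem (hle hXM) (hle hYM) (hle hwM) hpM hpq hpr
      rintro x ((rfl | rfl | rfl | rfl | rfl) | hx)
      exacts [hpM, this.1, this.2, hle (F.f₁_mem hXM hYM hwM), hle (F.f₂_mem hXM hYM hwM),
        hle (IntermediateField.subset_adjoin _ _ (Or.inr hx))]
  have hsub : ∀ {T : Set E} {x : E}, x ∈ T → x ∈ IntermediateField.adjoin k T :=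
    fun hx => IntermediateField.subset_adjoin _ _ hx
  have step₂ : Descent Γ (IntermediateField.adjoin k (S ∪ {F.a}))
      (IntermediateField.adjoin k S) := by
    rw [IntermediateField.adjoin_union]
    refine Descent.of_quadratic (s := 0) (n := -(F.q * F.r)) (g := g₂) h₂ ?_ (zero_mem _)
      (neg_mem (mul_mem (hsub (by simp [hS])) (hsub (by simp [hS])))) ?_ ?_
    · rintro x ((rfl | rfl | rfl | rfl | rfl) | hx)
      exacts [hp₂, hq₂, hr₂, hf₁₂, hf₂₂, hB _ h₂ _ hx]
    · rw [q_mul_r]; ring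
    · rw [ha₂]; exact neg_ne _ F.generic.a_ne
  have step₁ : Descent Γ (IntermediateField.adjoin k (S ∪ {F.a} ∪ {F.b}))
      (IntermediateField.adjoin k (S ∪ {F.a})) := by
    rw [IntermediateField.adjoin_union k (S := S ∪ {F.a})]
    refine Descent.of_quadratic (s := 0) (n := -(F.r * F.p)) (g := g₁) h₁ ?_ (zero_mem _)
      (neg_mem (mul_mem (hsub (by simp [hS])) (hsub (by simp [hS])))) ?_ ?_
    · rintro x (((rfl | rfl | rfl | rfl | rfl) | hx) | rfl)
      exacts [hp₁, hq₁, hr₁, hf₁₁, hf₂₁, hB _ h₁ _ hx, ha₁]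
    · rw [r_mul_p]; ring
    · rw [hb₁]; exact neg_ne _ F.generic.b_ne
  refine ((step₁.trans step₂).trans step₃).mono subset_rfl ?_
  rw [IntermediateField.adjoin_le_iff]
  set M := IntermediateField.adjoin k (S ∪ {F.a} ∪ {F.b})
  have ha : F.a ∈ M := hsub (by simp)
  have hb : F.b ∈ M := hsub (by simp)
  have hc : F.c ∈ M := by
    have h : F.c = F.p * F.q * F.r / (F.a * F.b) := by
      have := F.generic.a_ne; have := F.generic.b_ne
      rw [p_mul_q_mul_r]; field_simp
    rw [h]
    exact div_mem (mul_mem (mul_mem (hsub (by simp [hS])) (hsub (by simp [hS])))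
      (hsub (by simp [hS]))) (mul_mem ha hb)
  have hd := F.d_mem ha hb hc (hsub (by simp [hS])) (hsub (by simp [hS]))
  rintro x ((rfl | rfl | rfl | rfl | rfl | rfl) | hx)
  exacts [ha, hb, hc, hd.1, hd.2.1, hd.2.2, hsub (by simp [hS, hx])]

end Descent

end Frame
end

/-! ### Further symmetries of a frame -/

namespace Frame

variable {E : Type*} [Field E] {k : Type*} [Field k] [Algebra k E] {κ lam : ℕ} (F : Frame E κ lam)

/-- The cross product of the axis with `(e₁, e₂, e₃)`, by the triple product expansion. -/
theorem cross_e : F.b * F.e₃ - F.c * F.e₂ = -κ * F.d₁ ∧ F.c * F.e₁ - F.a * F.e₃ = -κ * F.d₂ ∧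
    F.a * F.e₂ - F.b * F.e₁ = -κ * F.d₃ := by
  rw [← F.norm_axis]
  simp only [e₁, e₂, e₃]
  refine ⟨?_, ?_, ?_⟩
  · linear_combination F.a * F.orth
  · linear_combination F.b * F.orth
  · linear_combination F.c * F.orth

/-- Effect of an odd symmetry of the axis, which exchanges `p` and `r`. -/
theorem map_flip {g : E ≃ₐ[k] E} (ha : g F.a = -F.c) (hb : g F.b = F.b) (hc : g F.c = -F.a) :
    g F.u = F.v ∧ g F.v = F.u ∧ g F.l = F.l ∧ g F.w = F.w / F.t ∧ g F.t = F.t⁻¹ := by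
  have hp : g F.p = F.r := by
    simp only [p, r, map_div₀, map_mul, ha, hb, hc]; ring
  have hq : g F.q = F.q := by
    simp only [q, map_div₀, map_mul, ha, hb, hc]; ring
  have hr : g F.r = F.p := by
    simp only [p, r, map_div₀, map_mul, ha, hb, hc]; ring
  have hn : g F.n = F.n := by
    simp only [n, map_sub, map_add, map_mul, map_pow, hp, hq, hr]; ring
  have hu : g F.u = F.v := by
    simp only [u, v, map_div₀, map_sub, map_add, map_mul, map_pow, hp, hq, hr, hn, map_ofNat]; ring
  have hv : g F.v = F.u := by
    simp only [u, v, map_div₀, map_sub, map_add, map_mul, map_pow, hp, hq, hr, hn, map_ofNat]; ring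
  have hl : g F.l = F.l := by
    simp only [l, map_sub, map_add, map_mul, map_pow, hu, hv]; ring
  have h1 := F.u_ne
  have h2 := F.v_ne
  refine ⟨hu, hv, hl, ?_, ?_⟩
  · simp only [w, t, map_div₀, hl, hu]; field_simp
  · simp only [t, map_div₀, hu, hv, inv_div]

/-- An odd symmetry of an axis of square norm `1` that also exchanges `(d₁, d₂, d₃)` with the cross
product. -/
theorem map_flip_swap (F : Frame E 1 lam) {g : E ≃ₐ[k] E}
    (ha : g F.a = -F.c) (hb : g F.b = F.b) (hc : g F.c = -F.a)
    (hd₁ : g F.d₁ = -F.e₃) (hd₂ : g F.d₂ = F.e₂) (hd₃ : g F.d₃ = -F.e₁) :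
    g F.X = -F.Y / F.t ∧ g F.Y = -F.X / F.t := by
  obtain ⟨hu, hv, hl, -, -⟩ := F.map_flip ha hb hc
  obtain ⟨k₁, k₂, k₃⟩ := F.cross_e
  have hf₁ : g F.f₁ = F.f₂ := by
    simp only [f₁, f₂, map_add, map_div₀, ha, hb, hc, hd₁, hd₂, hd₃, neg_div_neg_eq]; ring
  have he₁ : g F.e₁ = -F.d₃ := by
    have : g F.e₁ = F.a * F.e₂ - F.b * F.e₁ := by
      simp only [e₁.eq_1 F, map_sub, map_mul, hb, hc, hd₂, hd₃]; ring
    rw [this, k₃]; simp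
  have he₂ : g F.e₂ = F.d₂ := by
    have : g F.e₂ = -(F.c * F.e₁ - F.a * F.e₃) := by
      simp only [e₂.eq_1 F, map_sub, map_mul, ha, hc, hd₁, hd₃]; ring
    rw [this, k₂]; simp
  have he₃ : g F.e₃ = -F.d₁ := by
    have : g F.e₃ = F.b * F.e₃ - F.c * F.e₂ := by
      simp only [e₃.eq_1 F, map_sub, map_mul, ha, hb, hd₁, hd₂]; ring
    rw [this, k₁]; simp
  have hf₂ : g F.f₂ = F.f₁ := by
    simp only [f₁, f₂, map_add, map_div₀, ha, hb, hc, he₁, he₂, he₃, neg_div_neg_eq]; ring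
  have hnf : g F.nf = F.nf := by
    simp only [nf, map_add, map_pow, hf₁, hf₂, Nat.cast_one, div_one]; ring
  have h1 := F.u_ne
  have h2 := F.v_ne
  have h3 := F.nf_ne
  constructor
  · simp only [X, Y, t, map_div₀, map_sub, map_add, map_mul, map_ofNat, hl, hu, hv,
      hf₁, hf₂, hnf, Nat.cast_one, map_one, div_one]
    field_simp
    ring
  · simp only [X, Y, t, map_div₀, map_sub, map_mul, map_ofNat, hl, hu, hv,
      hf₁, hf₂, hnf, Nat.cast_one, map_one, div_one]
    field_simp
    ring

/-- An odd symmetry of an axis of square norm `3` combined with a reflection of the plane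
perpendicular to the axis. -/
theorem map_flip_reflect (F : Frame E 3 lam) {g : E ≃ₐ[k] E}
    (ha : g F.a = -F.c) (hb : g F.b = F.b) (hc : g F.c = -F.a)
    (hd₁ : g F.d₁ = -(F.e₃ + F.d₃) / 2) (hd₂ : g F.d₂ = (F.e₂ + F.d₂) / 2)
    (hd₃ : g F.d₃ = -(F.e₁ + F.d₁) / 2) :
    g F.X = (F.X - 3 * F.Y) / (2 * F.t) ∧ g F.Y = -(F.X + F.Y) / (2 * F.t) := by
  obtain ⟨hu, hv, hl, -, -⟩ := F.map_flip ha hb hc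
  obtain ⟨k₁, k₂, k₃⟩ := F.cross_e
  have h0 := F.two_ne
  have h3 : (3 : E) ≠ 0 := by simpa using F.κ_ne
  have hA := F.generic.a_ne
  have hB := F.generic.b_ne
  have hC := F.generic.c_ne
  have hf₁ : g F.f₁ = (F.f₁ + F.f₂) / 2 := by
    simp only [f₁, f₂, map_add, map_div₀, ha, hb, hc, hd₁, hd₂, hd₃]; field_simp; ring
  push_cast at k₁ k₂ k₃
  have he₁ : g F.e₁ = (F.e₃ - 3 * F.d₃) / 2 := by
    have : g F.e₁ = ((F.a * F.e₂ - F.b * F.e₁) + F.e₃) / 2 := by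
      simp only [e₁.eq_1 F, map_sub, map_mul, hb, hc, hd₂, hd₃]; simp only [e₃]; ring
    rw [this, k₃]; ring
  have he₂ : g F.e₂ = (3 * F.d₂ - F.e₂) / 2 := by
    have : g F.e₂ = -((F.c * F.e₁ - F.a * F.e₃) + F.e₂) / 2 := by
      simp only [e₂.eq_1 F, map_sub, map_mul, ha, hc, hd₁, hd₃]; ring
    rw [this, k₂]; ring
  have he₃ : g F.e₃ = (F.e₁ - 3 * F.d₁) / 2 := by
    have : g F.e₃ = ((F.b * F.e₃ - F.c * F.e₂) + F.e₁) / 2 := by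
      simp only [e₃.eq_1 F, map_sub, map_mul, ha, hb, hd₁, hd₂]; simp only [e₁]; ring
    rw [this, k₁]; ring
  have hf₂ : g F.f₂ = (3 * F.f₁ - F.f₂) / 2 := by
    simp only [f₁, f₂, map_add, map_div₀, ha, hb, hc, he₁, he₂, he₃]; field_simp; ring
  have hnf : g F.nf = F.nf := by
    simp only [nf, map_add, map_div₀, map_pow, hf₁, hf₂, Nat.cast_ofNat, map_ofNat]
    field_simp; ring
  have h1 := F.u_ne
  have h2 := F.v_ne
  have h4 := F.nf_ne
  constructor
  · simp only [X, Y, t, map_div₀, map_sub, map_add, map_mul, map_ofNat, hl, hu, hv,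
      hf₁, hf₂, hnf, Nat.cast_ofNat]
    field_simp
    ring
  · simp only [X, Y, t, map_div₀, map_sub, map_mul, map_ofNat, hl, hu, hv,
      hf₁, hf₂, hnf, Nat.cast_ofNat]
    field_simp
    ring

/-- A rotation by a third of a turn in the plane perpendicular to an axis of square norm `3`. It
acts on `X + √-3 Y` as multiplication by a cube root of unity. -/
theorem map_rotate (F : Frame E 3 lam) {g : E ≃ₐ[k] E}
    (ha : g F.a = F.a) (hb : g F.b = F.b) (hc : g F.c = F.c)
    (hd₁ : g F.d₁ = (F.e₁ - F.d₁) / 2) (hd₂ : g F.d₂ = (F.e₂ - F.d₂) / 2)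
    (hd₃ : g F.d₃ = (F.e₃ - F.d₃) / 2) :
    g F.X = -(F.X + 3 * F.Y) / 2 ∧ g F.Y = (F.X - F.Y) / 2 ∧ g F.w = F.w := by
  obtain ⟨k₁, k₂, k₃⟩ := F.cross_e
  have h0 := F.two_ne
  have h3 : (3 : E) ≠ 0 := by simpa using F.κ_ne
  have hu : g F.u = F.u := by
    simp only [u, n, p, q, r, map_div₀, map_sub, map_add, map_mul, map_pow, ha, hb, hc, map_ofNat]
  have hv : g F.v = F.v := by
    simp only [v, n, p, q, r, map_div₀, map_sub, map_add, map_mul, map_pow, ha, hb, hc, map_ofNat]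
  have hl : g F.l = F.l := by simp only [l, map_sub, map_add, map_mul, map_pow, hu, hv]
  have hf₁ : g F.f₁ = (F.f₂ - F.f₁) / 2 := by
    simp only [f₁, f₂, map_add, map_div₀, ha, hb, hc, hd₁, hd₂, hd₃]; ring
  push_cast at k₁ k₂ k₃
  have he₁ : g F.e₁ = -(3 * F.d₁ + F.e₁) / 2 := by
    have : g F.e₁ = ((F.b * F.e₃ - F.c * F.e₂) - F.e₁) / 2 := by
      simp only [e₁.eq_1 F, map_sub, map_mul, hb, hc, hd₂, hd₃]; ring
    rw [this, k₁]; ring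
  have he₂ : g F.e₂ = -(3 * F.d₂ + F.e₂) / 2 := by
    have : g F.e₂ = ((F.c * F.e₁ - F.a * F.e₃) - F.e₂) / 2 := by
      simp only [e₂.eq_1 F, map_sub, map_mul, ha, hc, hd₁, hd₃]; ring
    rw [this, k₂]; ring
  have he₃ : g F.e₃ = -(3 * F.d₃ + F.e₃) / 2 := by
    have : g F.e₃ = ((F.a * F.e₂ - F.b * F.e₁) - F.e₃) / 2 := by
      simp only [e₃.eq_1 F, map_sub, map_mul, ha, hb, hd₁, hd₂]; ring
    rw [this, k₃]; ring
  have hf₂ : g F.f₂ = -(3 * F.f₁ + F.f₂) / 2 := by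
    simp only [f₁, f₂, map_add, map_div₀, ha, hb, hc, he₁, he₂, he₃]; ring
  have hnf : g F.nf = F.nf := by
    simp only [nf, map_add, map_div₀, map_pow, hf₁, hf₂, Nat.cast_ofNat, map_ofNat]
    field_simp; ring
  have h1 := F.u_ne
  have h4 := F.nf_ne
  refine ⟨?_, ?_, ?_⟩
  · simp only [X, Y, map_div₀, map_sub, map_add, map_mul, map_ofNat, hl, hu, hv,
      hf₁, hf₂, hnf, Nat.cast_ofNat]
    field_simp
    ring
  · simp only [X, Y, map_div₀, map_sub, map_mul, map_ofNat, hl, hu, hv,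
      hf₁, hf₂, hnf, Nat.cast_ofNat]
    field_simp
    ring
  · simp only [w, map_div₀, hl, hu]

end Frame

/-! ### Descent along a rotation of order three and along an inversion -/

section

variable {k E : Type*} [Field k] [Field E] [Algebra k E]

/-- If `g` multiplies `z = X + √-3 Y` by a cube root of unity, the invariants are generated by the
two components of `z³ / |z|² = z² / z̄`. Here `X` is a root of a cubic over these invariants, the
triple angle formula. -/
theorem Descent.rotation {Γ : Set (E ≃ₐ[k] E)} {S : Set E} {X Y : E} {g : E ≃ₐ[k] E}
    (hg : g ∈ Γ) (h2 : (2 : E) ≠ 0) (h3 : (3 : E) ≠ 0) (hN : X ^ 2 + 3 * Y ^ 2 ≠ 0)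
    (hS : ∀ x ∈ S, g x = x) (hX : g X = -(X + 3 * Y) / 2) (hY : g Y = (X - Y) / 2) :
    (g ((X ^ 3 - 9 * X * Y ^ 2) / (X ^ 2 + 3 * Y ^ 2)) =
        (X ^ 3 - 9 * X * Y ^ 2) / (X ^ 2 + 3 * Y ^ 2) ∧
      g ((3 * X ^ 2 * Y - 3 * Y ^ 3) / (X ^ 2 + 3 * Y ^ 2)) =
        (3 * X ^ 2 * Y - 3 * Y ^ 3) / (X ^ 2 + 3 * Y ^ 2)) ∧
    Descent Γ (IntermediateField.adjoin k ({X, Y} ∪ S))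
      (IntermediateField.adjoin k ({(X ^ 3 - 9 * X * Y ^ 2) / (X ^ 2 + 3 * Y ^ 2),
        (3 * X ^ 2 * Y - 3 * Y ^ 3) / (X ^ 2 + 3 * Y ^ 2)} ∪ S)) := by
  set N := X ^ 2 + 3 * Y ^ 2 with hNdef
  set m₁ := (X ^ 3 - 9 * X * Y ^ 2) / N with hm₁
  set m₂ := (3 * X ^ 2 * Y - 3 * Y ^ 3) / N with hm₂
  have hnorm : m₁ ^ 2 + 3 * m₂ ^ 2 = N := by
    rw [hm₁, hm₂]; field_simp; rw [hNdef]; ring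
  have hgN : g N = N := by
    simp only [hNdef, map_add, map_mul, map_pow, map_ofNat, hX, hY]; field_simp; ring
  have hg₁ : g m₁ = m₁ := by
    simp only [hm₁, hgN, map_div₀, map_sub, map_mul, map_pow, map_ofNat, hX, hY]
    field_simp; ring
  have hg₂ : g m₂ = m₂ := by
    simp only [hm₂, hgN, map_div₀, map_sub, map_mul, map_pow, map_ofNat, hX, hY]
    field_simp; ring
  refine ⟨⟨hg₁, hg₂⟩, ?_⟩
  -- `X = ± Y` is impossible: applying `g` to `X² = Y²` gives `XY = 0`.
  have hsq : X ^ 2 - Y ^ 2 ≠ 0 := by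
    intro h
    have h' := congrArg g h
    rw [map_sub, map_pow, map_pow, hX, hY, map_zero] at h'
    field_simp at h'
    have hXY : Y * (X + Y) = 0 := by
      have h8 : (2 : E) ^ 3 ≠ 0 := pow_ne_zero 3 h2
      apply (mul_eq_zero.1 (_ : (2 : E) ^ 3 * (Y * (X + Y)) = 0)).resolve_left h8
      linear_combination h'
    have hX0 : X * (X + Y) = 0 := by linear_combination h + hXY
    rcases mul_eq_zero.1 hXY with h0 | h0
    · rw [h0] at h
      have : X ^ 2 = 0 := by linear_combination h
      apply hN
      rw [hNdef, this, h0]; ring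
    · have hXe : X = -Y := by linear_combination h0
      have hgX : g X = X := by rw [hX, hXe]; field_simp; ring
      have hgY : g Y = g (-X) := by rw [hXe, neg_neg]
      rw [hY, map_neg, hgX, hXe] at hgY
      have h4 : (2 : E) * (2 * Y) = 0 := by
        field_simp at hgY
        linear_combination -hgY
      have hY0 : Y = 0 :=
        (mul_eq_zero.1 ((mul_eq_zero.1 h4).resolve_left h2)).resolve_left h2
      apply hN
      rw [hNdef, hXe, hY0]; ring
  have hsub : ∀ {T : Set E} {x : E}, x ∈ T → x ∈ IntermediateField.adjoin k T :=
    fun hx => IntermediateField.subset_adjoin _ _ hx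
  set T : Set E := {m₁, m₂} ∪ S with hT
  set M := IntermediateField.adjoin k T with hM
  have hm₁M : m₁ ∈ M := hsub (by simp [hT])
  have hm₂M : m₂ ∈ M := hsub (by simp [hT])
  have nat_mem : ∀ (L : IntermediateField k E) (m : ℕ), (m : E) ∈ L := fun L m => natCast_mem L m
  have hNM : N ∈ M := by
    rw [← hnorm]
    exact add_mem (pow_mem hm₁M 2) (mul_mem (by exact_mod_cast nat_mem M 3) (pow_mem hm₂M 2))
  have h34 : (3 / 4 : E) ∈ M := by exact_mod_cast div_mem (nat_mem M 3) (nat_mem M 4)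
  have h14 : (1 / 4 : E) ∈ M := by exact_mod_cast div_mem (nat_mem M 1) (nat_mem M 4)
  have h4 : (4 : E) ≠ 0 := by
    rw [show (4 : E) = 2 * 2 by norm_num]; exact mul_ne_zero h2 h2
  refine (Descent.of_cubic (θ := X) (s := 0) (t := -(3 / 4 * N)) (n := -(1 / 4 * (m₁ * N)))
    (g := g) hg ?_ (zero_mem _) (neg_mem (mul_mem h34 hNM))
    (neg_mem (mul_mem h14 (mul_mem hm₁M hNM))) ?_ ?_).mono subset_rfl ?_
  · rintro x ((rfl | rfl) | hx)
    exacts [hg₁, hg₂, hS x hx]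
  · have : m₁ * N = X ^ 3 - 9 * X * Y ^ 2 := div_mul_cancel₀ _ hN
    rw [this, hNdef]
    field_simp
    ring
  · intro h
    rw [hX] at h
    field_simp at h
    apply hsq
    have h5 : (3 : E) * (X + Y) = 0 := by linear_combination -h
    have h6 := (mul_eq_zero.1 h5).resolve_left h3
    linear_combination (X - Y) * h6
  · rw [IntermediateField.adjoin_le_iff]
    have hle : M ≤ M ⊔ IntermediateField.adjoin k {X} := le_sup_left
    have hXM : X ∈ M ⊔ IntermediateField.adjoin k {X} :=
      (le_sup_right : IntermediateField.adjoin k {X} ≤ _)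
        (IntermediateField.mem_adjoin_simple_self k X)
    have hYM : Y ∈ M ⊔ IntermediateField.adjoin k {X} := by
      have hd : 4 * X ^ 2 - N ≠ 0 := by
        rw [show 4 * X ^ 2 - N = 3 * (X ^ 2 - Y ^ 2) by rw [hNdef]; ring]
        exact mul_ne_zero h3 hsq
      have : Y = m₂ * N / (4 * X ^ 2 - N) := by
        rw [eq_div_iff hd, hm₂, div_mul_cancel₀ _ hN, hNdef]; ring
      rw [this]
      exact div_mem (mul_mem (hle hm₂M) (hle hNM)) (sub_mem (mul_mem
        (by exact_mod_cast nat_mem _ 4) (pow_mem hXM 2)) (hle hNM))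
    rintro x ((rfl | rfl) | hx)
    exacts [hXM, hYM, hle (hsub (Or.inr hx))]

/-- An involution `g` that divides the coordinates `s`, `t`, `w` by a diagonal quadratic form `c` in
them, up to a sign on `t`, sends `c` to its inverse. Its field of invariants is generated by three
elements, over which `t` is quadratic: `c / t²` is a rational function of them. -/
theorem Descent.inversion {Γ : Set (E ≃ₐ[k] E)} {S : Set E} {s t w c : E} {α β γ : k}
    {g : E ≃ₐ[k] E} (hg : g ∈ Γ) (h2 : (2 : E) ≠ 0)
    (hc : c = algebraMap k E α * s ^ 2 + algebraMap k E β * t ^ 2 + algebraMap k E γ * w ^ 2)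
    (hind : AlgebraicIndependent k ![s, t, w])
    (hS : ∀ x ∈ S, g x = x) (hs : g s = s / c) (ht : g t = -t / c) (hw : g w = w / c) :
    (g ((1 + c) / w) = (1 + c) / w ∧ g (s / w) = s / w ∧ g ((1 - c) / t) = (1 - c) / t) ∧
    Descent Γ (IntermediateField.adjoin k ({s, t, w} ∪ S))
      (IntermediateField.adjoin k ({(1 + c) / w, s / w, (1 - c) / t} ∪ S)) := by
  -- polynomial relations among `s`, `t`, `w` may be tested at a point
  have ne_of_eval : ∀ P : MvPolynomial (Fin 3) k,
      (∃ x : Fin 3 → k, MvPolynomial.eval x P ≠ 0) → MvPolynomial.aeval ![s, t, w] P ≠ 0 := by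
    rintro P ⟨x, hx⟩ h
    rw [hind.eq_zero_of_aeval_eq_zero P h, map_zero] at hx
    exact hx rfl
  have ht0 : t ≠ 0 := hind.ne_zero 1
  have hw0 : w ≠ 0 := hind.ne_zero 2
  let Pc : MvPolynomial (Fin 3) k := .C α * .X 0 ^ 2 + .C β * .X 1 ^ 2 + .C γ * .X 2 ^ 2
  have hPc : MvPolynomial.aeval ![s, t, w] Pc = c := by simp [Pc, hc]
  have hc1 : 1 + c ≠ 0 := by
    have := ne_of_eval (1 + Pc) ⟨0, by simp [Pc]⟩
    simpa only [map_add, map_one, hPc] using this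
  have hG : (1 - c) ^ 2 + 4 * algebraMap k E β * t ^ 2 ≠ 0 := by
    have := ne_of_eval ((1 - Pc) ^ 2 + 4 * .C β * .X 1 ^ 2) ⟨0, by simp [Pc]⟩
    simpa [hPc] using this
  have hc0 : c ≠ 0 := by
    rintro rfl
    rw [div_zero] at hs
    rw [div_zero] at ht
    exact ht0 (g.injective (by rw [ht, map_zero]))
  have hgc : g c = c⁻¹ := by
    have : g c = c / c ^ 2 := by
      conv_lhs => rw [hc]
      simp only [map_add, map_mul, map_pow, AlgEquiv.commutes, hs, ht, hw]
      linear_combination -(c ^ 2)⁻¹ * hc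
    rw [this]; field_simp
  set T₁ := (1 + c) / w with hT₁
  set T₂ := s / w with hT₂
  set T₃ := (1 - c) / t with hT₃
  have hg₁ : g T₁ = T₁ := by
    rw [hT₁, map_div₀, map_add, map_one, hgc, hw]; field_simp; ring
  have hg₂ : g T₂ = T₂ := by
    rw [hT₂, map_div₀, hs, hw]; field_simp
  have hg₃ : g T₃ = T₃ := by
    rw [hT₃, map_div₀, map_sub, map_one, hgc, ht]; field_simp; ring
  refine ⟨⟨hg₁, hg₂, hg₃⟩, ?_⟩
  have hsub : ∀ {T : Set E} {x : E}, x ∈ T → x ∈ IntermediateField.adjoin k T :=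
    fun hx => IntermediateField.subset_adjoin _ _ hx
  set T : Set E := {T₁, T₂, T₃} ∪ S with hT
  set M := IntermediateField.adjoin k T with hM
  have h₁M : T₁ ∈ M := hsub (by simp [hT])
  have h₂M : T₂ ∈ M := hsub (by simp [hT])
  have h₃M : T₃ ∈ M := hsub (by simp [hT])
  have e₁ : T₁ * w = 1 + c := div_mul_cancel₀ _ hw0
  have e₂ : T₂ * w = s := div_mul_cancel₀ _ hw0
  have e₃ : T₃ * t = 1 - c := div_mul_cancel₀ _ ht0
  have nat_mem : ∀ (L : IntermediateField k E) (m : ℕ), (m : E) ∈ L := fun L m => natCast_mem L m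
  have four_mem : (4 : E) ∈ M := by exact_mod_cast nat_mem M 4
  have h4 : (4 : E) ≠ 0 := by
    rw [show (4 : E) = 2 * 2 by norm_num]; exact mul_ne_zero h2 h2
  set G := T₁ ^ 2 - 4 * algebraMap k E α * T₂ ^ 2 - 4 * algebraMap k E γ with hGdef
  have hGw : G * w ^ 2 = (T₃ ^ 2 + 4 * algebraMap k E β) * t ^ 2 := by
    have : G * w ^ 2 = (T₁ * w) ^ 2 - 4 * algebraMap k E α * (T₂ * w) ^ 2
      - 4 * algebraMap k E γ * w ^ 2 := by rw [hGdef]; ring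
    have h' : (T₃ ^ 2 + 4 * algebraMap k E β) * t ^ 2 =
        (T₃ * t) ^ 2 + 4 * algebraMap k E β * t ^ 2 := by
      ring
    rw [this, h', e₁, e₂, e₃]
    linear_combination 4 * hc
  have hG0 : G ≠ 0 := by
    intro h
    rw [h, zero_mul] at hGw
    apply hG
    rw [← e₃]
    linear_combination -hGw
  have hGM : G ∈ M := by
    rw [hGdef]
    exact sub_mem (sub_mem (pow_mem h₁M 2) (mul_mem (mul_mem four_mem (M.algebraMap_mem α))
      (pow_mem h₂M 2))) (mul_mem four_mem (M.algebraMap_mem γ))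
  -- `c / t²` is invariant
  set κ := (T₁ ^ 2 * ((T₃ ^ 2 + 4 * algebraMap k E β) / G) - T₃ ^ 2) / 4 with hκ
  have hκM : κ ∈ M := by
    rw [hκ]
    exact div_mem (sub_mem (mul_mem (pow_mem h₁M 2) (div_mem (add_mem (pow_mem h₃M 2)
      (mul_mem four_mem (M.algebraMap_mem β))) hGM)) (pow_mem h₃M 2)) four_mem
  have hκt : κ * t ^ 2 = c := by
    have h5 : (T₃ ^ 2 + 4 * algebraMap k E β) / G * t ^ 2 = w ^ 2 := by
      rw [div_mul_eq_mul_div, ← hGw, mul_div_cancel_left₀ _ hG0]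
    have : κ * t ^ 2 =
        (T₁ ^ 2 * ((T₃ ^ 2 + 4 * algebraMap k E β) / G * t ^ 2) - (T₃ * t) ^ 2) / 4 := by
      rw [hκ]; ring
    rw [this, h5, ← mul_pow, e₁, e₃]
    field_simp
    ring
  have hκ0 : κ ≠ 0 := by
    intro h
    rw [h, zero_mul] at hκt
    exact hc0 hκt.symm
  refine (Descent.of_quadratic (θ := t) (s := T₃ / κ) (n := -(1 / κ)) (g := g) hg ?_
    (div_mem h₃M hκM) (neg_mem (div_mem (one_mem _) hκM)) ?_ ?_).mono subset_rfl ?_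
  · rintro x ((rfl | rfl | rfl) | hx)
    exacts [hg₁, hg₂, hg₃, hS x hx]
  · field_simp
    linear_combination hκt + e₃
  · rw [ht]
    intro h
    apply mul_ne_zero ht0 hc1
    field_simp at h
    linear_combination -h * t
  · rw [IntermediateField.adjoin_le_iff]
    have hle : M ≤ M ⊔ IntermediateField.adjoin k {t} := le_sup_left
    have htM : t ∈ M ⊔ IntermediateField.adjoin k {t} :=
      (le_sup_right : IntermediateField.adjoin k {t} ≤ _)
        (IntermediateField.mem_adjoin_simple_self k t)
    have hT₁0 : T₁ ≠ 0 := div_ne_zero hc1 hw0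
    have hwM : w ∈ M ⊔ IntermediateField.adjoin k {t} := by
      have : w = (2 - T₃ * t) / T₁ := by
        rw [eq_div_iff hT₁0, e₃, mul_comm, e₁]; ring
      rw [this]
      exact div_mem (sub_mem (by exact_mod_cast nat_mem _ 2) (mul_mem (hle h₃M) htM)) (hle h₁M)
    rintro x ((rfl | rfl | rfl) | hx)
    · rw [← e₂]; exact mul_mem (hle h₂M) hwM
    · exact htM
    · exact hwM
    · exact hle (hsub (Or.inr hx))

end

/-! ### The rotation matrix of a quaternion -/

section Rotation

/-- The sum of four squares, the norm of the quaternion with coordinates `x`. -/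
def nsq {A : Type*} [CommRing A] (x : Fin 4 → A) : A := x 0 ^ 2 + x 1 ^ 2 + x 2 ^ 2 + x 3 ^ 2

/-- The matrix of quadratic forms in `x` which, divided by `nsq x`, is the rotation matrix of the
quaternion with coordinates `x`. -/
def quat {A : Type*} [CommRing A] (x : Fin 4 → A) : Matrix (Fin 3) (Fin 3) A :=
  !![x 0 ^ 2 + x 1 ^ 2 - x 2 ^ 2 - x 3 ^ 2,
       2 * (x 1 * x 2 + x 0 * x 3), 2 * (x 1 * x 3 - x 0 * x 2);
     2 * (x 1 * x 2 - x 0 * x 3),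
       x 0 ^ 2 - x 1 ^ 2 + x 2 ^ 2 - x 3 ^ 2, 2 * (x 2 * x 3 + x 0 * x 1);
     2 * (x 1 * x 3 + x 0 * x 2), 2 * (x 2 * x 3 - x 0 * x 1),
       x 0 ^ 2 - x 1 ^ 2 - x 2 ^ 2 + x 3 ^ 2]

theorem map_nsq {A B : Type*} [CommRing A] [CommRing B] (φ : A →+* B) (x : Fin 4 → A) :
    φ (nsq x) = nsq (fun i => φ (x i)) := by
  simp only [nsq, map_add, map_pow]

theorem map_quat {A B : Type*} [CommRing A] [CommRing B] (φ : A →+* B) (x : Fin 4 → A)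
    (i j : Fin 3) : φ (quat x i j) = quat (fun i => φ (x i)) i j := by
  fin_cases i <;> fin_cases j <;> simp [quat, map_ofNat]

variable {E : Type*} [Field E]

/-- The entries of the rotation matrix attached to `x`, homogeneous of degree zero in `x`. -/
def rot (x : Fin 4 → E) (i j : Fin 3) : E := quat x i j / nsq x

theorem rot_col_dot {x : Fin 4 → E} (hx : nsq x ≠ 0) (j j' : Fin 3) :
    rot x 0 j * rot x 0 j' + rot x 1 j * rot x 1 j' + rot x 2 j * rot x 2 j' =
      if j = j' then 1 else 0 := by
  have h : quat x 0 j * quat x 0 j' + quat x 1 j * quat x 1 j' + quat x 2 j * quat x 2 j' =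
      if j = j' then nsq x ^ 2 else 0 := by
    fin_cases j <;> fin_cases j' <;> simp [quat, nsq] <;> ring
  simp only [rot]
  have e : quat x 0 j / nsq x * (quat x 0 j' / nsq x) + quat x 1 j / nsq x * (quat x 1 j' / nsq x) +
      quat x 2 j / nsq x * (quat x 2 j' / nsq x) =
      (quat x 0 j * quat x 0 j' + quat x 1 j * quat x 1 j' + quat x 2 j * quat x 2 j') /
        nsq x ^ 2 := by
    field_simp
  rw [e, h]
  split_ifs
  · exact div_self (pow_ne_zero 2 hx)
  · exact zero_div _

/-- In a rotation matrix each entry equals its cofactor; row and column indices are taken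
modulo three. -/
theorem rot_cofactor {x : Fin 4 → E} (hx : nsq x ≠ 0) (i j : Fin 3) :
    rot x (i + 1) (j + 1) * rot x (i + 2) (j + 2) - rot x (i + 1) (j + 2) * rot x (i + 2) (j + 1) =
      rot x i j := by
  have h : quat x (i + 1) (j + 1) * quat x (i + 2) (j + 2) -
      quat x (i + 1) (j + 2) * quat x (i + 2) (j + 1) = nsq x * quat x i j := by
    fin_cases i <;> fin_cases j <;> simp [quat, nsq] <;> ring
  simp only [rot]
  rw [div_mul_div_comm, div_mul_div_comm, ← sub_div, h]
  field_simp

theorem map_rot {k : Type*} [Field k] [Algebra k E] (g : E ≃ₐ[k] E) (x : Fin 4 → E) (i j : Fin 3) :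
    g (rot x i j) = rot (fun i => g (x i)) i j := by
  have h1 := map_quat (g : E →+* E) x i j
  have h2 := map_nsq (g : E →+* E) x
  simp only [rot, map_div₀]
  exact congrArg₂ _ h1 h2

theorem rot_div {x : Fin 4 → E} {t : E} (ht : t ≠ 0) (i j : Fin 3) :
    rot (fun l => x l / t) i j = rot x i j := by
  have hq : quat (fun l => x l / t) i j = quat x i j / t ^ 2 := by
    fin_cases i <;> fin_cases j <;> simp [quat] <;> field_simp
  have hn : nsq (fun l => x l / t) = nsq x / t ^ 2 := by
    simp only [nsq]; field_simp
  rw [rot, hq, hn, div_div_div_cancel_right₀ (pow_ne_zero 2 ht), rot]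

section Mem
variable {k : Type*} [Field k] [Algebra k E] {M : IntermediateField k E} {x : Fin 4 → E}

theorem rot_mem (hx : ∀ l, x l ∈ M) (i j : Fin 3) : rot x i j ∈ M := by
  let y : Fin 4 → M := fun l => ⟨x l, hx l⟩
  have h1 := map_quat (algebraMap M E) y i j
  have h2 := map_nsq (algebraMap M E) y
  have : rot x i j = algebraMap M E (quat y i j) / algebraMap M E (nsq y) := by
    rw [h1, h2]; rfl
  rw [this]
  exact div_mem (quat y i j).2 (nsq y).2

/-- The rotation matrix determines the quaternion up to scaling. -/
theorem div_mem_of_rot_mem (h2 : (2 : E) ≠ 0) (hn : nsq x ≠ 0) (h3 : x 3 ≠ 0)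
    (h : ∀ i j, rot x i j ∈ M) (j : Fin 4) : x j / x 3 ∈ M := by
  have h4 : (4 : E) ≠ 0 := by
    rw [show (4 : E) = 2 * 2 by norm_num]; exact mul_ne_zero h2 h2
  have hd : 1 - rot x 0 0 - rot x 1 1 + rot x 2 2 = 4 * (x 3 * x 3) / nsq x := by
    rw [eq_div_iff hn]
    simp only [rot, add_mul, sub_mul, div_mul_cancel₀ _ hn]
    simp [quat, nsq]; ring
  have hdM : 4 * (x 3 * x 3) / nsq x ∈ M := by
    rw [← hd]
    exact add_mem (sub_mem (sub_mem (one_mem _) (h _ _)) (h _ _)) (h _ _)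
  have key : ∀ l, 4 * (x l * x 3) / nsq x ∈ M → x l / x 3 ∈ M := by
    intro l hl
    have : x l / x 3 = (4 * (x l * x 3) / nsq x) / (4 * (x 3 * x 3) / nsq x) := by
      field_simp
    rw [this]
    exact div_mem hl hdM
  apply key
  fin_cases j
  · have : 4 * (x 0 * x 3) / nsq x = rot x 0 1 - rot x 1 0 := by
      simp only [rot, ← sub_div]; congr 1; simp [quat]; ring
    exact this ▸ sub_mem (h _ _) (h _ _)
  · have : 4 * (x 1 * x 3) / nsq x = rot x 0 2 + rot x 2 0 := by
      simp only [rot, ← add_div]; congr 1; simp [quat]; ring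
    exact this ▸ add_mem (h _ _) (h _ _)
  · have : 4 * (x 2 * x 3) / nsq x = rot x 1 2 + rot x 2 1 := by
      simp only [rot, ← add_div]; congr 1; simp [quat]; ring
    exact this ▸ add_mem (h _ _) (h _ _)
  · exact hdM

end Mem

end Rotation

/-! ### The action of the generators on the rotation matrix -/

section Generators
variable {E : Type*} [Field E] {x y : Fin 4 → E}

theorem rot_eq_of_quat_eq {s : E} {i j i' j' : Fin 3} (h : quat y i j = s * quat x i' j')
    (hn : nsq y = nsq x) : rot y i j = s * rot x i' j' := by
  rw [rot, rot, h, hn, mul_div_assoc]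

theorem act_lam1 (h₀ : y 0 = x 1) (h₁ : y 1 = -x 0) (h₂ : y 2 = -x 3) (h₃ : y 3 = x 2) :
    nsq y = nsq x ∧ ∀ j, rot y 0 j = 1 * rot x 0 j ∧ rot y 1 j = -1 * rot x 1 j ∧
      rot y 2 j = -1 * rot x 2 j := by
  have hn : nsq y = nsq x := by simp only [nsq, h₀, h₁, h₂, h₃]; ring
  refine ⟨hn, fun j =>
    ⟨rot_eq_of_quat_eq ?_ hn, rot_eq_of_quat_eq ?_ hn, rot_eq_of_quat_eq ?_ hn⟩⟩ <;>
    fin_cases j <;> simp [quat, h₀, h₁, h₂, h₃, -mul_eq_mul_left_iff] <;> ring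

theorem act_lam2 (h₀ : y 0 = x 2) (h₁ : y 1 = x 3) (h₂ : y 2 = -x 0) (h₃ : y 3 = -x 1) :
    nsq y = nsq x ∧ ∀ j, rot y 0 j = -1 * rot x 0 j ∧ rot y 1 j = 1 * rot x 1 j ∧
      rot y 2 j = -1 * rot x 2 j := by
  have hn : nsq y = nsq x := by simp only [nsq, h₀, h₁, h₂, h₃]; ring
  refine ⟨hn, fun j =>
    ⟨rot_eq_of_quat_eq ?_ hn, rot_eq_of_quat_eq ?_ hn, rot_eq_of_quat_eq ?_ hn⟩⟩ <;>
    fin_cases j <;> simp [quat, h₀, h₁, h₂, h₃, -mul_eq_mul_left_iff] <;> ring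

theorem act_sig (h2 : (2 : E) ≠ 0) (h₀ : y 0 = 1 / 2 * (-x 0 - x 1 - x 2 - x 3))
    (h₁ : y 1 = 1 / 2 * (x 0 - x 1 + x 2 - x 3)) (h₂ : y 2 = 1 / 2 * (x 0 - x 1 - x 2 + x 3))
    (h₃ : y 3 = 1 / 2 * (x 0 + x 1 - x 2 - x 3)) :
    nsq y = nsq x ∧ ∀ j, rot y 0 j = 1 * rot x 2 j ∧ rot y 1 j = 1 * rot x 0 j ∧
      rot y 2 j = 1 * rot x 1 j := by
  have hn : nsq y = nsq x := by simp only [nsq, h₀, h₁, h₂, h₃]; field_simp; ring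
  refine ⟨hn, fun j =>
    ⟨rot_eq_of_quat_eq ?_ hn, rot_eq_of_quat_eq ?_ hn, rot_eq_of_quat_eq ?_ hn⟩⟩ <;>
    fin_cases j <;> simp [quat, h₀, h₁, h₂, h₃, -mul_eq_mul_left_iff] <;> field_simp <;> ring

theorem act_tau (h₀ : y 0 = -x 2) (h₁ : y 1 = -x 1) (h₂ : y 2 = -x 0) (h₃ : y 3 = x 3) :
    nsq y = nsq x ∧ ∀ j, rot y 0 j = -1 * rot x 2 (2 - j) ∧ rot y 1 j = 1 * rot x 1 (2 - j) ∧
      rot y 2 j = -1 * rot x 0 (2 - j) := by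
  have hn : nsq y = nsq x := by simp only [nsq, h₀, h₁, h₂, h₃]; ring
  refine ⟨hn, fun j =>
    ⟨rot_eq_of_quat_eq ?_ hn, rot_eq_of_quat_eq ?_ hn, rot_eq_of_quat_eq ?_ hn⟩⟩ <;>
    fin_cases j <;> simp [quat, h₀, h₁, h₂, h₃, -mul_eq_mul_left_iff] <;> ring

theorem act_lam3 (h2 : (2 : E) ≠ 0) (h₀ : y 0 = 1 / 2 * (-x 0 - x 1 - x 2 + x 3))
    (h₁ : y 1 = 1 / 2 * (x 0 - x 1 + x 2 + x 3)) (h₂ : y 2 = 1 / 2 * (x 0 - x 1 - x 2 - x 3))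
    (h₃ : y 3 = 1 / 2 * (-x 0 - x 1 + x 2 - x 3)) :
    nsq y = nsq x ∧ ∀ i, rot y i 0 = -1 * rot x i 2 ∧ rot y i 1 = 1 * rot x i 0 ∧
      rot y i 2 = -1 * rot x i 1 := by
  have hn : nsq y = nsq x := by simp only [nsq, h₀, h₁, h₂, h₃]; field_simp; ring
  refine ⟨hn, fun j =>
    ⟨rot_eq_of_quat_eq ?_ hn, rot_eq_of_quat_eq ?_ hn, rot_eq_of_quat_eq ?_ hn⟩⟩ <;>
    fin_cases j <;> simp [quat, h₀, h₁, h₂, h₃, -mul_eq_mul_left_iff] <;> field_simp <;> ring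

theorem act_lam4 (h₀ : y 0 = x 0) (h₁ : y 1 = x 3) (h₂ : y 2 = -x 2) (h₃ : y 3 = x 1) :
    nsq y = nsq x ∧ (∀ j, j ≠ 1 → rot y 0 j = 1 * rot x 2 (2 - j) ∧
      rot y 1 j = -1 * rot x 1 (2 - j) ∧
      rot y 2 j = 1 * rot x 0 (2 - j)) ∧ rot y 0 1 = -1 * rot x 2 1 ∧ rot y 1 1 = 1 * rot x 1 1 ∧
      rot y 2 1 = -1 * rot x 0 1 := by
  have hn : nsq y = nsq x := by simp only [nsq, h₀, h₁, h₂, h₃]; ring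
  refine ⟨hn, fun j hj =>
    ⟨rot_eq_of_quat_eq ?_ hn, rot_eq_of_quat_eq ?_ hn, rot_eq_of_quat_eq ?_ hn⟩,
    rot_eq_of_quat_eq ?_ hn, rot_eq_of_quat_eq ?_ hn, rot_eq_of_quat_eq ?_ hn⟩
  on_goal 1 => fin_cases j <;> simp [quat, h₀, h₁, h₂, h₃, -mul_eq_mul_left_iff] at hj ⊢ <;> ring
  on_goal 1 => fin_cases j <;> simp [quat, h₀, h₁, h₂, h₃, -mul_eq_mul_left_iff] at hj ⊢ <;> ring
  on_goal 1 => fin_cases j <;> simp [quat, h₀, h₁, h₂, h₃, -mul_eq_mul_left_iff] at hj ⊢ <;> ring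
  all_goals simp [quat, h₀, h₁, h₂, h₃, -mul_eq_mul_left_iff]; ring

end Generators

section Action
variable {k : Type*} [Field k]

theorem adjoin_range_var : IntermediateField.adjoin k (Set.range (var k)) = ⊤ := by
  rw [eq_top_iff]
  rintro f -
  have hpoly : ∀ p : MvPolynomial (Fin 4) k,
      algebraMap (MvPolynomial (Fin 4) k) (RatFun4 k) p ∈
        IntermediateField.adjoin k (Set.range (var k)) := by
    intro p
    induction p using MvPolynomial.induction_on with
    | C a =>
      rw [← MvPolynomial.algebraMap_eq, ← IsScalarTower.algebraMap_apply]
      exact IntermediateField.algebraMap_mem _ a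
    | add p q hp hq => rw [map_add]; exact add_mem hp hq
    | mul_X p i hp =>
      rw [map_mul]
      exact mul_mem hp (IntermediateField.subset_adjoin _ _ ⟨i, rfl⟩)
  obtain ⟨p, q, -, rfl⟩ := IsFractionRing.div_surjective (A := MvPolynomial (Fin 4) k) f
  exact div_mem (hpoly p) (hpoly q)

theorem nsq_var_ne_zero : nsq (var k) ≠ 0 := by
  have h : nsq (var k) = algebraMap (MvPolynomial (Fin 4) k) (RatFun4 k) (nsq MvPolynomial.X) :=
    (map_nsq (algebraMap (MvPolynomial (Fin 4) k) (RatFun4 k)) _).symm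
  rw [h]
  refine (map_ne_zero_iff _ (IsFractionRing.injective _ _)).2 fun h0 => ?_
  have := congrArg (MvPolynomial.eval (Pi.single 0 1 : Fin 4 → k)) h0
  simp [nsq] at this

theorem rot_mem_projField (i j : Fin 3) : rot (var k) i j ∈ projField k := by
  rw [← rot_div (var_ne_zero (k := k) 3)]
  exact rot_mem var_div_mem_projField i j

theorem ratAct_rot (g : GL (Fin 4) k) (i j : Fin 3) :
    ratAct g (rot (var k) i j) = rot (fun l => ratAct g (var k l)) i j := map_rot _ _ _ _

theorem ratAct_nsq (g : GL (Fin 4) k) :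
    ratAct g (nsq (var k)) = nsq (fun l => ratAct g (var k l)) :=
  map_nsq (ratAct g : RatFun4 k →+* RatFun4 k) _

variable {g : GL (Fin 4) k}

theorem ratAct_lam1 (hg : (g : Matrix (Fin 4) (Fin 4) k) = lam1 k) :
    ratAct g (nsq (var k)) = nsq (var k) ∧ ∀ j, ratAct g (rot (var k) 0 j) = rot (var k) 0 j ∧
      ratAct g (rot (var k) 1 j) = -rot (var k) 1 j ∧
      ratAct g (rot (var k) 2 j) = -rot (var k) 2 j := by
  simp only [ratAct_rot, ratAct_nsq]
  simpa using act_lam1 (x := var k) (y := fun l => ratAct g (var k l))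
    (by simp [ratAct_var, hg, lam1, Fin.sum_univ_four])
    (by simp [ratAct_var, hg, lam1, Fin.sum_univ_four])
    (by simp [ratAct_var, hg, lam1, Fin.sum_univ_four])
    (by simp [ratAct_var, hg, lam1, Fin.sum_univ_four])

theorem ratAct_lam2 (hg : (g : Matrix (Fin 4) (Fin 4) k) = lam2 k) :
    ratAct g (nsq (var k)) = nsq (var k) ∧ ∀ j, ratAct g (rot (var k) 0 j) = -rot (var k) 0 j ∧
      ratAct g (rot (var k) 1 j) = rot (var k) 1 j ∧
      ratAct g (rot (var k) 2 j) = -rot (var k) 2 j := by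
  simp only [ratAct_rot, ratAct_nsq]
  simpa using act_lam2 (x := var k) (y := fun l => ratAct g (var k l))
    (by simp [ratAct_var, hg, lam2, Fin.sum_univ_four])
    (by simp [ratAct_var, hg, lam2, Fin.sum_univ_four])
    (by simp [ratAct_var, hg, lam2, Fin.sum_univ_four])
    (by simp [ratAct_var, hg, lam2, Fin.sum_univ_four])

theorem ratAct_sig (h2 : (2 : RatFun4 k) ≠ 0) (hg : (g : Matrix (Fin 4) (Fin 4) k) = sig k) :
    ratAct g (nsq (var k)) = nsq (var k) ∧ ∀ j, ratAct g (rot (var k) 0 j) = rot (var k) 2 j ∧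
      ratAct g (rot (var k) 1 j) = rot (var k) 0 j ∧
      ratAct g (rot (var k) 2 j) = rot (var k) 1 j := by
  simp only [ratAct_rot, ratAct_nsq]
  simpa using act_sig (x := var k) (y := fun l => ratAct g (var k l)) h2
    (by simp [ratAct_var, hg, sig, Fin.sum_univ_four, map_ofNat]; ring)
    (by simp [ratAct_var, hg, sig, Fin.sum_univ_four, map_ofNat]; ring)
    (by simp [ratAct_var, hg, sig, Fin.sum_univ_four, map_ofNat]; ring)
    (by simp [ratAct_var, hg, sig, Fin.sum_univ_four, map_ofNat]; ring)

theorem ratAct_tau (hg : (g : Matrix (Fin 4) (Fin 4) k) = tau k) :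
    ratAct g (nsq (var k)) = nsq (var k) ∧ ∀ j,
      ratAct g (rot (var k) 0 j) = -rot (var k) 2 (2 - j) ∧
      ratAct g (rot (var k) 1 j) = rot (var k) 1 (2 - j) ∧
      ratAct g (rot (var k) 2 j) = -rot (var k) 0 (2 - j) := by
  simp only [ratAct_rot, ratAct_nsq]
  simpa using act_tau (x := var k) (y := fun l => ratAct g (var k l))
    (by simp [ratAct_var, hg, tau, Fin.sum_univ_four])
    (by simp [ratAct_var, hg, tau, Fin.sum_univ_four])
    (by simp [ratAct_var, hg, tau, Fin.sum_univ_four])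
    (by simp [ratAct_var, hg, tau, Fin.sum_univ_four])

theorem ratAct_lam3 (h2 : (2 : RatFun4 k) ≠ 0) (hg : (g : Matrix (Fin 4) (Fin 4) k) = lam3 k) :
    ratAct g (nsq (var k)) = nsq (var k) ∧ ∀ i, ratAct g (rot (var k) i 0) = -rot (var k) i 2 ∧
      ratAct g (rot (var k) i 1) = rot (var k) i 0 ∧
      ratAct g (rot (var k) i 2) = -rot (var k) i 1 := by
  simp only [ratAct_rot, ratAct_nsq]
  simpa using act_lam3 (x := var k) (y := fun l => ratAct g (var k l)) h2
    (by simp [ratAct_var, hg, lam3, Fin.sum_univ_four, map_ofNat]; ring)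
    (by simp [ratAct_var, hg, lam3, Fin.sum_univ_four, map_ofNat]; ring)
    (by simp [ratAct_var, hg, lam3, Fin.sum_univ_four, map_ofNat]; ring)
    (by simp [ratAct_var, hg, lam3, Fin.sum_univ_four, map_ofNat]; ring)

theorem ratAct_lam4 (hg : (g : Matrix (Fin 4) (Fin 4) k) = lam4 k) :
    ratAct g (nsq (var k)) = nsq (var k) ∧
    (∀ j, j ≠ 1 → ratAct g (rot (var k) 0 j) = rot (var k) 2 (2 - j) ∧
      ratAct g (rot (var k) 1 j) = -rot (var k) 1 (2 - j) ∧
      ratAct g (rot (var k) 2 j) = rot (var k) 0 (2 - j)) ∧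
    ratAct g (rot (var k) 0 1) = -rot (var k) 2 1 ∧ ratAct g (rot (var k) 1 1) = rot (var k) 1 1 ∧
      ratAct g (rot (var k) 2 1) = -rot (var k) 0 1 := by
  simp only [ratAct_rot, ratAct_nsq]
  simpa using act_lam4 (x := var k) (y := fun l => ratAct g (var k l))
    (by simp [ratAct_var, hg, lam4, Fin.sum_univ_four])
    (by simp [ratAct_var, hg, lam4, Fin.sum_univ_four])
    (by simp [ratAct_var, hg, lam4, Fin.sum_univ_four])
    (by simp [ratAct_var, hg, lam4, Fin.sum_univ_four])

end Action

/-! ### Frames formed from the columns of a rotation matrix -/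

section
variable {E : Type*} [Field E]

/-- The frame with axis the middle column of a rotation matrix and perpendicular vector the last
column. -/
def coordinateFrame (x : Fin 4 → E) (h2 : (2 : E) ≠ 0) (hx : nsq x ≠ 0)
    (hgen : IsGenericAxis (rot x 0 1) (rot x 1 1) (rot x 2 1)) : Frame E 1 1 where
  a := rot x 0 1
  b := rot x 1 1
  c := rot x 2 1
  d₁ := rot x 0 2
  d₂ := rot x 1 2
  d₃ := rot x 2 2
  norm_axis := by simpa [sq] using rot_col_dot hx 1 1
  orth := by simpa using rot_col_dot hx 1 2
  norm_d := by simpa [sq] using rot_col_dot hx 2 2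
  κ_ne := by simp
  lam_ne := by simp
  two_ne := h2
  generic := hgen

/-- The cross product for `coordinateFrame` is the first column. -/
theorem coordinateFrame_e (x : Fin 4 → E) (h2 : (2 : E) ≠ 0) (hx : nsq x ≠ 0)
    (hgen : IsGenericAxis (rot x 0 1) (rot x 1 1) (rot x 2 1)) :
    (coordinateFrame x h2 hx hgen).e₁ = rot x 0 0 ∧ (coordinateFrame x h2 hx hgen).e₂ = rot x 1 0 ∧
      (coordinateFrame x h2 hx hgen).e₃ = rot x 2 0 := by
  have h0 := rot_cofactor hx 0 0
  have h1 := rot_cofactor hx 1 0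
  have h2 := rot_cofactor hx 2 0
  simp only [Fin.reduceAdd] at h0 h1 h2
  simp only [Frame.e₁, Frame.e₂, Frame.e₃, coordinateFrame]
  exact ⟨by linear_combination h0, by linear_combination h1, by linear_combination h2⟩

/-- The frame whose axis is the sum of the first two columns minus the third and whose
perpendicular vector is the difference of the first two columns. The axis is the combination of the
columns fixed by the signed cyclic permutation of the columns that `lam3` induces. -/
def diagonalFrame (x : Fin 4 → E) (h2 : (2 : E) ≠ 0) (h3 : (3 : E) ≠ 0) (hx : nsq x ≠ 0)
    (hgen : IsGenericAxis (rot x 0 0 + rot x 0 1 - rot x 0 2) (rot x 1 0 + rot x 1 1 - rot x 1 2)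
      (rot x 2 0 + rot x 2 1 - rot x 2 2)) : Frame E 3 2 where
  a := rot x 0 0 + rot x 0 1 - rot x 0 2
  b := rot x 1 0 + rot x 1 1 - rot x 1 2
  c := rot x 2 0 + rot x 2 1 - rot x 2 2
  d₁ := rot x 0 0 - rot x 0 1
  d₂ := rot x 1 0 - rot x 1 1
  d₃ := rot x 2 0 - rot x 2 1
  norm_axis := by
    have h00 := rot_col_dot hx 0 0
    have h11 := rot_col_dot hx 1 1
    have h22 := rot_col_dot hx 2 2
    have h01 := rot_col_dot hx 0 1
    have h02 := rot_col_dot hx 0 2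
    have h12 := rot_col_dot hx 1 2
    simp only [reduceIte, Fin.reduceEq] at h00 h11 h22 h01 h02 h12
    push_cast
    linear_combination h00 + h11 + h22 + 2 * h01 - 2 * h02 - 2 * h12
  orth := by
    have h00 := rot_col_dot hx 0 0
    have h11 := rot_col_dot hx 1 1
    have h02 := rot_col_dot hx 0 2
    have h12 := rot_col_dot hx 1 2
    simp only [reduceIte, Fin.reduceEq] at h00 h11 h02 h12
    linear_combination h00 - h11 - h02 + h12
  norm_d := by
    have h00 := rot_col_dot hx 0 0
    have h11 := rot_col_dot hx 1 1
    have h01 := rot_col_dot hx 0 1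
    simp only [reduceIte, Fin.reduceEq] at h00 h11 h01
    push_cast
    linear_combination h00 + h11 - 2 * h01
  κ_ne := by simpa using h3
  lam_ne := by simpa using h2
  two_ne := h2
  generic := hgen

/-- The cross product for `diagonalFrame` is again a combination of columns. -/
theorem diagonalFrame_e (x : Fin 4 → E) (h2 : (2 : E) ≠ 0) (h3 : (3 : E) ≠ 0) (hx : nsq x ≠ 0)
    (hgen : IsGenericAxis (rot x 0 0 + rot x 0 1 - rot x 0 2) (rot x 1 0 + rot x 1 1 - rot x 1 2)
      (rot x 2 0 + rot x 2 1 - rot x 2 2)) :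
    (diagonalFrame x h2 h3 hx hgen).e₁ = -(rot x 0 0 + rot x 0 1 + 2 * rot x 0 2) ∧
    (diagonalFrame x h2 h3 hx hgen).e₂ = -(rot x 1 0 + rot x 1 1 + 2 * rot x 1 2) ∧
    (diagonalFrame x h2 h3 hx hgen).e₃ = -(rot x 2 0 + rot x 2 1 + 2 * rot x 2 2) := by
  have c := fun i j => rot_cofactor hx i j
  simp only [Frame.e₁, Frame.e₂, Frame.e₃, diagonalFrame]
  refine ⟨?_, ?_, ?_⟩
  · have h0 := c 0 0
    have h1 := c 0 1
    have h2 := c 0 2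
    simp only [Fin.reduceAdd] at h0 h1 h2
    linear_combination -h0 - h1 - 2 * h2
  · have h0 := c 1 0
    have h1 := c 1 1
    have h2 := c 1 2
    simp only [Fin.reduceAdd] at h0 h1 h2
    linear_combination -h0 - h1 - 2 * h2
  · have h0 := c 2 0
    have h1 := c 2 1
    have h2 := c 2 2
    simp only [Fin.reduceAdd] at h0 h1 h2
    linear_combination -h0 - h1 - 2 * h2

theorem Frame.XYw_mem {κ lam : ℕ} (F : Frame E κ lam) {k : Type*} [Field k] [Algebra k E]
    {M : IntermediateField k E} (ha : F.a ∈ M) (hb : F.b ∈ M) (hc : F.c ∈ M) (hd₁ : F.d₁ ∈ M)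
    (hd₂ : F.d₂ ∈ M) (hd₃ : F.d₃ ∈ M) : F.X ∈ M ∧ F.Y ∈ M ∧ F.w ∈ M := by
  have hκ := natCast_mem M κ
  have := natCast_mem M 3
  have hp : F.p ∈ M := div_mem (mul_mem hb hc) ha
  have hq : F.q ∈ M := div_mem (mul_mem hc ha) hb
  have hr : F.r ∈ M := div_mem (mul_mem ha hb) hc
  have he₁ : F.e₁ ∈ M := sub_mem (mul_mem hb hd₃) (mul_mem hc hd₂)
  have he₂ : F.e₂ ∈ M := sub_mem (mul_mem hc hd₁) (mul_mem ha hd₃)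
  have he₃ : F.e₃ ∈ M := sub_mem (mul_mem ha hd₂) (mul_mem hb hd₁)
  have hf₁ : F.f₁ ∈ M := add_mem (add_mem (div_mem hd₁ ha) (div_mem hd₂ hb)) (div_mem hd₃ hc)
  have hf₂ : F.f₂ ∈ M := add_mem (add_mem (div_mem he₁ ha) (div_mem he₂ hb)) (div_mem he₃ hc)
  have hn : F.n ∈ M := by
    simp only [Frame.n]; apply_rules [sub_mem, add_mem, mul_mem, pow_mem]
  have hu : F.u ∈ M := by
    simp only [Frame.u]; apply_rules [sub_mem, add_mem, mul_mem, pow_mem, div_mem]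
  have hv : F.v ∈ M := by
    simp only [Frame.v]; apply_rules [sub_mem, add_mem, mul_mem, pow_mem, div_mem]
  have hl := F.l_mem hu hv
  have hnf : F.nf ∈ M := add_mem (pow_mem hf₁ 2) (div_mem (pow_mem hf₂ 2) hκ)
  refine ⟨?_, ?_, div_mem hl hu⟩
  · simp only [Frame.X]; apply_rules [sub_mem, add_mem, mul_mem, div_mem]
  · simp only [Frame.Y]; apply_rules [sub_mem, add_mem, mul_mem, div_mem]

end

section
variable {k : Type*} [Field k]

theorem two_ne_zero_ratFun4 (h2 : (2 : k) ≠ 0) : (2 : RatFun4 k) ≠ 0 := by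
  have := (map_ne_zero (algebraMap k (RatFun4 k))).2 h2
  rwa [map_ofNat] at this

theorem three_ne_zero_ratFun4 (h3 : (3 : k) ≠ 0) : (3 : RatFun4 k) ≠ 0 := by
  have := (map_ne_zero (algebraMap k (RatFun4 k))).2 h3
  rwa [map_ofNat] at this

/-- The combination of the columns of the rotation matrix with integral coefficients `m` is a
generic axis as soon as the quadratic forms `∑ j, m j * quat x i j` take values `s`, `s`, `0` with
`s ≠ 0` at some point over the algebraic closure and the last one is not the zero form. -/
theorem isGenericAxis_of_eval (h2 : (2 : k) ≠ 0) (m : Fin 3 → ℤ) (z : Fin 4 → AlgebraicClosure k)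
    (s : AlgebraicClosure k) (hs : s ≠ 0)
    (h₀ : ∑ j, (m j : AlgebraicClosure k) * quat z 0 j = s)
    (h₁ : ∑ j, (m j : AlgebraicClosure k) * quat z 1 j = s)
    (h₂ : ∑ j, (m j : AlgebraicClosure k) * quat z 2 j = 0)
    (z' : Fin 4 → k) (h : ∑ j, (m j : k) * quat z' 2 j ≠ 0) :
    IsGenericAxis (∑ j, (m j : RatFun4 k) * rot (var k) 0 j)
      (∑ j, (m j : RatFun4 k) * rot (var k) 1 j) (∑ j, (m j : RatFun4 k) * rot (var k) 2 j) := by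
  let P : Fin 3 → MvPolynomial (Fin 4) k := fun i => ∑ j, (m j : MvPolynomial (Fin 4) k) *
    quat MvPolynomial.X i j
  have hmap : ∀ {K : Type _} [CommRing K] (φ : MvPolynomial (Fin 4) k →+* K) (i : Fin 3),
      φ (P i) = ∑ j, (m j : K) * quat (fun l => φ (MvPolynomial.X l)) i j := by
    intro K _ φ i
    simp only [P, map_sum, map_mul, map_intCast, map_quat]
  have hrot : ∀ i, ∑ j, (m j : RatFun4 k) * rot (var k) i j =
      algebraMap (MvPolynomial (Fin 4) k) (RatFun4 k) (P i) / nsq (var k) := by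
    intro i
    rw [hmap, Finset.sum_div]
    exact Finset.sum_congr rfl fun j _ => (mul_div_assoc _ _ _).symm
  have hev : ∀ i, (MvPolynomial.aeval z : MvPolynomial (Fin 4) k →ₐ[k] AlgebraicClosure k) (P i) =
      ∑ j, (m j : AlgebraicClosure k) * quat z i j := by
    intro i
    have := hmap ((MvPolynomial.aeval z : MvPolynomial (Fin 4) k →ₐ[k] AlgebraicClosure k) :
      MvPolynomial (Fin 4) k →+* AlgebraicClosure k) i
    simpa using this
  rw [hrot, hrot, hrot]
  refine IsGenericAxis.div nsq_var_ne_zero (IsGenericAxis.map (IsFractionRing.injective _ _)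
    (IsGenericAxis.of_eval ((MvPolynomial.aeval z : MvPolynomial (Fin 4) k →ₐ[k]
      AlgebraicClosure k) : MvPolynomial (Fin 4) k →+* AlgebraicClosure k) (s := s) ?_ hs
      ((hev 0).trans h₀) ((hev 1).trans h₁) ((hev 2).trans h₂) ?_))
  · have := (map_ne_zero (algebraMap k (AlgebraicClosure k))).2 h2
    rwa [map_ofNat] at this
  · intro h0
    apply h
    have := hmap (MvPolynomial.eval z') 2
    rw [h0, map_zero] at this
    simpa using this.symm

/-- The point used is `(0, 1, 1 + √2, 0)`. -/
theorem isGenericAxis_coordinate (h2 : (2 : k) ≠ 0) :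
    IsGenericAxis (rot (var k) 0 1) (rot (var k) 1 1) (rot (var k) 2 1) := by
  have h2' : (2 : AlgebraicClosure k) ≠ 0 := by
    have := (map_ne_zero (algebraMap k (AlgebraicClosure k))).2 h2
    rwa [map_ofNat] at this
  obtain ⟨n, hn⟩ := IsAlgClosed.exists_pow_nat_eq (2 : AlgebraicClosure k) (n := 2) two_pos
  have := isGenericAxis_of_eval h2 ![0, 1, 0] ![0, 1, 1 + n, 0] (2 * (1 + n)) ?_ ?_ ?_ ?_
    ![1, 1, 0, 0] ?_
  · simpa [Fin.sum_univ_three] using this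
  · refine mul_ne_zero h2' fun h => one_ne_zero (α := AlgebraicClosure k) ?_
    linear_combination -hn + (n - 1) * h
  · simp [Fin.sum_univ_three, quat]
  · simp [Fin.sum_univ_three, quat]
    linear_combination hn
  · simp [Fin.sum_univ_three, quat]
  · simpa [Fin.sum_univ_three, quat] using h2

/-- The point used is `(0, 3 + √6, 3 + √6, -√6)`. -/
theorem isGenericAxis_diagonal (h2 : (2 : k) ≠ 0) (h3 : (3 : k) ≠ 0) :
    IsGenericAxis (rot (var k) 0 0 + rot (var k) 0 1 - rot (var k) 0 2)
      (rot (var k) 1 0 + rot (var k) 1 1 - rot (var k) 1 2)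
      (rot (var k) 2 0 + rot (var k) 2 1 - rot (var k) 2 2) := by
  have h2' : (2 : AlgebraicClosure k) ≠ 0 := by
    have := (map_ne_zero (algebraMap k (AlgebraicClosure k))).2 h2
    rwa [map_ofNat] at this
  have h3' : (3 : AlgebraicClosure k) ≠ 0 := by
    have := (map_ne_zero (algebraMap k (AlgebraicClosure k))).2 h3
    rwa [map_ofNat] at this
  obtain ⟨n, hn⟩ := IsAlgClosed.exists_pow_nat_eq (6 : AlgebraicClosure k) (n := 2) two_pos
  have := isGenericAxis_of_eval h2 ![1, 1, -1] ![0, 3 + n, 3 + n, -n]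
    (2 * (3 * 3) * (2 + n)) ?_ ?_ ?_ ?_ ![1, 0, 0, 0] ?_
  · simpa [Fin.sum_univ_three, sub_eq_add_neg] using this
  · refine mul_ne_zero (mul_ne_zero h2' (mul_ne_zero h3' h3')) fun h => h2' ?_
    linear_combination -hn + (n - 2) * h
  · simp [Fin.sum_univ_three, quat]
    linear_combination 3 * hn
  · simp [Fin.sum_univ_three, quat]
    linear_combination 3 * hn
  · simp [Fin.sum_univ_three, quat]
    linear_combination -3 * hn
  · simp [Fin.sum_univ_three, quat]

/-! ### Triples that generate fixed fields -/

/-- The automorphisms of the rational function field that come from `G`. -/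
def automorphisms (G : Subgroup (GL (Fin 4) k)) : Set (RatFun4 k ≃ₐ[k] RatFun4 k) :=
  {e | ∃ g ∈ G, ratAct g = e}

/-- The first step for the full rational function field: an element acting as `-1` moves the last
variable, whose square is a rational function of the ratios and of the sum of squares. -/
theorem descent_var_div {G : Subgroup (GL (Fin 4) k)} (h2 : (2 : k) ≠ 0)
    {g : GL (Fin 4) k} (hgG : g ∈ G) (hg : ∀ j, ratAct g (var k j) = -var k j)  :
    Descent (automorphisms G) ⊤ (IntermediateField.adjoin k
      ({var k 0 / var k 3, var k 1 / var k 3, var k 2 / var k 3} ∪ {nsq (var k)})) := by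
  set S : Set (RatFun4 k) := {var k 0 / var k 3, var k 1 / var k 3, var k 2 / var k 3} ∪
    {nsq (var k)} with hS
  have h3 := var_ne_zero (k := k) 3
  have hn := nsq_var_ne_zero (k := k)
  have hsub : ∀ {x}, x ∈ S → x ∈ IntermediateField.adjoin k S :=
    fun hx => IntermediateField.subset_adjoin _ _ hx
  have hM : ∀ j, var k j / var k 3 ∈ IntermediateField.adjoin k S := by
    intro j
    fin_cases j
    · exact hsub (by simp [hS])
    · exact hsub (by simp [hS])
    · exact hsub (by simp [hS])
    · have : var k 3 / var k 3 = 1 := div_self h3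
      exact this ▸ one_mem _
  have hsq : var k 3 ^ 2 ∈ IntermediateField.adjoin k S := by
    have h : var k 3 ^ 2 = nsq (var k) / nsq (fun l => var k l / var k 3) := by
      have e : nsq (fun l => var k l / var k 3) = nsq (var k) / var k 3 ^ 2 := by
        simp only [nsq, div_pow, add_div]
      rw [e, div_div_cancel₀ hn]
    rw [h]
    refine div_mem (hsub (by simp [hS])) ?_
    exact add_mem (add_mem (add_mem (pow_mem (hM 0) 2) (pow_mem (hM 1) 2)) (pow_mem (hM 2) 2))
      (pow_mem (hM 3) 2)
  have hmem : ratAct g ∈ automorphisms G := ⟨g, hgG, rfl⟩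
  refine (Descent.of_quadratic (θ := var k 3) (s := 0) (n := -(var k 3 ^ 2)) (g := ratAct g)
    hmem ?_ (zero_mem _) (neg_mem hsq) ?_ ?_).mono subset_rfl ?_
  · rintro x ((rfl | rfl | rfl) | hx)
    · rw [map_div₀, hg, hg, neg_div_neg_eq]
    · rw [map_div₀, hg, hg, neg_div_neg_eq]
    · rw [map_div₀, hg, hg, neg_div_neg_eq]
    · rw [Set.mem_singleton_iff.1 hx, ratAct_nsq]
      simp only [hg, nsq, neg_sq]
  · rw [zero_mul, add_zero, add_neg_cancel]
  · rw [hg]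
    intro h
    have : (2 : RatFun4 k) * var k 3 = 0 := by linear_combination -h
    exact mul_ne_zero (two_ne_zero_ratFun4 h2) h3 this
  · rw [← adjoin_range_var, IntermediateField.adjoin_le_iff]
    rintro _ ⟨j, rfl⟩
    have : var k j = var k j / var k 3 * var k 3 := (div_mul_cancel₀ _ h3).symm
    change var k j ∈ _
    rw [this]
    exact mul_mem ((le_sup_left : IntermediateField.adjoin k S ≤ _) (hM j))
      ((le_sup_right : IntermediateField.adjoin k {var k 3} ≤ _)
        (IntermediateField.mem_adjoin_simple_self k _))

/-- The elements `x`, `y`, `z` generate the invariants of `G` among the rational functions in the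
ratios of the variables, also after adjoining an arbitrary set `B` of invariants. Invariance of
`x`, `y`, `z` is not part of the definition. -/
def Generates (G : Subgroup (GL (Fin 4) k)) (x y z : RatFun4 k) : Prop :=
  ∀ B : Set (RatFun4 k), (∀ e ∈ automorphisms G, ∀ b ∈ B, e b = b) →
    Descent (automorphisms G) (IntermediateField.adjoin k
      ({var k 0 / var k 3, var k 1 / var k 3, var k 2 / var k 3} ∪ B))
      (IntermediateField.adjoin k ({x, y, z} ∪ B))

theorem range_vecCons_three {A : Type*} (x y z : A) : Set.range ![x, y, z] = {x, y, z} := by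
  simp only [Matrix.range_cons, Matrix.range_empty, Set.union_empty]
  rfl

theorem range_vecCons_four {A : Type*} (x y z t : A) :
    Set.range ![x, y, z, t] = {x, y, z} ∪ {t} := by
  simp only [Matrix.range_cons, Matrix.range_empty, Set.union_empty, Set.singleton_union,
    Set.insert_union]

variable {G : Subgroup (GL (Fin 4) k)} {x y z : RatFun4 k} {g : GL (Fin 4) k}

theorem Generates.descent_top (h : Generates G x y z) (h2 : (2 : k) ≠ 0)
    (hQ : nsq (var k) ∈ fixedField G) (hgG : g ∈ G) (hg : ∀ j, ratAct g (var k j) = -var k j) :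
    Descent (automorphisms G) ⊤ (IntermediateField.adjoin k ({x, y, z} ∪ {nsq (var k)})) :=
  (descent_var_div h2 hgG hg).trans (h _ (by
    rintro _ ⟨g', hg', rfl⟩ b rfl
    exact (mem_fixedField G _).1 hQ g' hg'))

theorem Generates.algebraicIndependent_nsq (h : Generates G x y z) (h2 : (2 : k) ≠ 0)
    (hQ : nsq (var k) ∈ fixedField G) (hgG : g ∈ G) (hg : ∀ j, ratAct g (var k j) = -var k j) :
    AlgebraicIndependent k ![x, y, z, nsq (var k)] := by
  have hd := h.descent_top h2 hQ hgG hg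
  refine algebraicIndependent_of_isAlgebraic (algebraicIndependent_var k) fun f => ?_
  rw [range_vecCons_four]
  exact hd.isAlgebraic f IntermediateField.mem_top

theorem Generates.algebraicIndependent (h : Generates G x y z) (h2 : (2 : k) ≠ 0)
    (hQ : nsq (var k) ∈ fixedField G) (hgG : g ∈ G) (hg : ∀ j, ratAct g (var k j) = -var k j) :
    AlgebraicIndependent k ![x, y, z] := by
  have e : ![x, y, z] = ![x, y, z, nsq (var k)] ∘ Fin.castSucc := by
    ext i
    fin_cases i <;> rfl
  rw [e]
  exact (h.algebraicIndependent_nsq h2 hQ hgG hg).comp _ (Fin.castSucc_injective 3)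

/-- A generating triple of invariants gives algebraically independent generators of both fixed
fields; the fourth generator of the larger one is the sum of squares of the variables. -/
theorem Generates.isPurelyGenerated (h : Generates G x y z) (h2 : (2 : k) ≠ 0)
    (hQ : nsq (var k) ∈ fixedField G) (hgG : g ∈ G) (hg : ∀ j, ratAct g (var k j) = -var k j)
    (hx : x ∈ projFixedField G) (hy : y ∈ projFixedField G) (hz : z ∈ projFixedField G) :
    IsPurelyGenerated (fixedField G) ∧ IsPurelyGenerated (projFixedField G) := by
  have hfix : ∀ f ∈ fixedField G, ∀ e ∈ automorphisms G, e f = f := by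
    rintro f hf _ ⟨g, hg, rfl⟩
    exact (mem_fixedField G f).1 hf g hg
  constructor
  · refine ⟨4, _, h.algebraicIndependent_nsq h2 hQ hgG hg, le_antisymm ?_ fun f hf => ?_⟩
    · rw [IntermediateField.adjoin_le_iff]
      rintro _ ⟨i, rfl⟩
      fin_cases i
      exacts [hx.2, hy.2, hz.2, hQ]
    · rw [range_vecCons_four]
      exact (h.descent_top h2 hQ hgG hg).mem f IntermediateField.mem_top (hfix f hf)
  · refine ⟨3, _, h.algebraicIndependent h2 hQ hgG hg, le_antisymm ?_ fun f hf => ?_⟩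
    · rw [IntermediateField.adjoin_le_iff]
      rintro _ ⟨i, rfl⟩
      fin_cases i
      exacts [hx, hy, hz]
    · rw [range_vecCons_three]
      have := (h ∅ (by simp)).mem f (by rw [Set.union_empty]; exact hf.1) (hfix f hf.2)
      rwa [Set.union_empty] at this

end

/-! ### The group generated by `lam1`, `lam2`, `sig` -/

section
variable {E : Type*} [Field E] {k : Type*} [Field k] [Algebra k E] {κ lam : ℕ}

theorem Frame.map_XYw (F : Frame E κ lam) {g : E ≃ₐ[k] E}
    (h : g F.p = F.p ∧ g F.q = F.q ∧ g F.r = F.r ∧ g F.f₁ = F.f₁ ∧ g F.f₂ = F.f₂) :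
    g F.X = F.X ∧ g F.Y = F.Y ∧ g F.w = F.w := by
  obtain ⟨hp, hq, hr, h₁, h₂⟩ := h
  simp only [X, Y, w, l, u, v, n, nf, map_div₀, map_sub, map_add, map_mul, map_pow, map_ofNat,
    map_natCast, hp, hq, hr, h₁, h₂, and_self]

end

section
variable {k : Type*} [Field k] {G : Subgroup (GL (Fin 4) k)}

theorem exists_mem_generatedBy (h2 : (2 : k) ≠ 0) {S : Set (Matrix (Fin 4) (Fin 4) k)}
    {M : Matrix (Fin 4) (Fin 4) k} (hM : M ∈ S)
    (hM' : M ∈ ({lam1 k, lam2 k, sig k, tau k, lam3 k, lam4 k} : Set _)) :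
    ∃ g ∈ generatedBy S, (g : Matrix (Fin 4) (Fin 4) k) = M := by
  obtain ⟨g, hg⟩ := generators_invertible k h2 M hM'
  exact ⟨g, Subgroup.subset_closure (by simpa [hg] using hM), hg⟩

/-- The square of `lam1` is `-1`. -/
theorem exists_neg_mem (h2 : (2 : k) ≠ 0) (hG : group3 k ≤ G) :
    ∃ g ∈ G, ∀ j, ratAct g (var k j) = -var k j := by
  obtain ⟨g, hgG, hg⟩ := exists_mem_generatedBy h2 (S := {lam1 k, lam2 k, sig k}) (M := lam1 k)
    (by simp) (by simp)
  have h₀ : ratAct g (var k 0) = var k 1 := by simp [ratAct_var, hg, lam1, Fin.sum_univ_four]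
  have h₁ : ratAct g (var k 1) = -var k 0 := by simp [ratAct_var, hg, lam1, Fin.sum_univ_four]
  have h₂ : ratAct g (var k 2) = -var k 3 := by simp [ratAct_var, hg, lam1, Fin.sum_univ_four]
  have h₃ : ratAct g (var k 3) = var k 2 := by simp [ratAct_var, hg, lam1, Fin.sum_univ_four]
  refine ⟨g * g, hG (mul_mem hgG hgG), fun j => ?_⟩
  rw [map_mul, AlgEquiv.mul_apply]
  fin_cases j
  · exact (congrArg _ h₀).trans h₁
  · exact (congrArg _ h₁).trans (by rw [map_neg, h₀]; rfl)
  · exact (congrArg _ h₂).trans (by rw [map_neg, h₃]; rfl)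
  · exact (congrArg _ h₃).trans h₂

theorem nsq_mem_fixedField (h2 : (2 : k) ≠ 0) {S : Set (Matrix (Fin 4) (Fin 4) k)}
    (hS : S ⊆ {lam1 k, lam2 k, sig k, tau k, lam3 k, lam4 k}) :
    nsq (var k) ∈ fixedField (generatedBy S) := by
  have h2' := two_ne_zero_ratFun4 h2
  rw [fixedField_generatedBy]
  intro g hg
  rcases hS hg with h | h | h | h | h | h
  exacts [(ratAct_lam1 h).1, (ratAct_lam2 h).1, (ratAct_sig h2' h).1, (ratAct_tau h).1,
    (ratAct_lam3 h2' h).1, (ratAct_lam4 h).1]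

/-- The axis and the perpendicular vector of `F` are the combinations of the columns of the rotation
matrix of the variables with integral coefficients `α` and `β`. -/
structure IsColumnFrame {κ lam : ℕ} (F : Frame (RatFun4 k) κ lam) (α β : Fin 3 → ℤ) : Prop where
  a_eq : F.a = ∑ j, (α j : RatFun4 k) * rot (var k) 0 j
  b_eq : F.b = ∑ j, (α j : RatFun4 k) * rot (var k) 1 j
  c_eq : F.c = ∑ j, (α j : RatFun4 k) * rot (var k) 2 j
  d₁_eq : F.d₁ = ∑ j, (β j : RatFun4 k) * rot (var k) 0 j
  d₂_eq : F.d₂ = ∑ j, (β j : RatFun4 k) * rot (var k) 1 j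
  d₃_eq : F.d₃ = ∑ j, (β j : RatFun4 k) * rot (var k) 2 j

section ColumnFrame
variable {κ lam : ℕ} {F : Frame (RatFun4 k) κ lam} {α β : Fin 3 → ℤ}

/-- `lam1` and `lam2` act as even sign changes of the rows and `sig` as a cyclic permutation. -/
theorem IsColumnFrame.map_group3 (hF : IsColumnFrame F α β) (h2 : (2 : k) ≠ 0) {g : GL (Fin 4) k}
    (hg : (g : Matrix (Fin 4) (Fin 4) k) ∈ ({lam1 k, lam2 k, sig k} : Set _)) :
    ratAct g F.X = F.X ∧ ratAct g F.Y = F.Y ∧ ratAct g F.w = F.w := by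
  obtain ⟨ha, hb, hc, hd₁, hd₂, hd₃⟩ := hF
  rcases hg with h | h | h
  · have := (ratAct_lam1 h).2
    apply F.map_XYw
    apply F.map_signs (ε₁ := 1) (ε₂ := -1) (ε₃ := -1) <;>
      simp [ha, hb, hc, hd₁, hd₂, hd₃, this]
  · have := (ratAct_lam2 h).2
    apply F.map_XYw
    apply F.map_signs (ε₁ := -1) (ε₂ := 1) (ε₃ := -1) <;>
      simp [ha, hb, hc, hd₁, hd₂, hd₃, this]
  · have := (ratAct_sig (two_ne_zero_ratFun4 h2) h).2
    refine (F.map_cycle ?_ ?_ ?_ ?_ ?_ ?_).2 <;>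
      simp [ha, hb, hc, hd₁, hd₂, hd₃, this]

theorem IsColumnFrame.XYw_mem_projField (hF : IsColumnFrame F α β) :
    F.X ∈ projField k ∧ F.Y ∈ projField k ∧ F.w ∈ projField k := by
  have key : ∀ (i : Fin 3) (m : Fin 3 → ℤ),
      ∑ j, (m j : RatFun4 k) * rot (var k) i j ∈ projField k := fun i m =>
    sum_mem fun j _ => mul_mem (intCast_mem _ _) (rot_mem_projField i j)
  exact F.XYw_mem (hF.a_eq ▸ key 0 α) (hF.b_eq ▸ key 1 α) (hF.c_eq ▸ key 2 α)
    (hF.d₁_eq ▸ key 0 β) (hF.d₂_eq ▸ key 1 β) (hF.d₃_eq ▸ key 2 β)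

theorem IsColumnFrame.generates (hF : IsColumnFrame F α β) (h2 : (2 : k) ≠ 0)
    (hG : group3 k ≤ G)
    (hrot : ∀ M : IntermediateField k (RatFun4 k), F.a ∈ M → F.b ∈ M → F.c ∈ M →
      F.d₁ ∈ M → F.d₂ ∈ M → F.d₃ ∈ M → ∀ i j, rot (var k) i j ∈ M) :
    Generates G F.X F.Y F.w := by
  intro B hB
  obtain ⟨g₁, hg₁, h₁⟩ := exists_mem_generatedBy h2 (S := {lam1 k, lam2 k, sig k}) (M := lam1 k)
    (by simp) (by simp)
  obtain ⟨g₂, hg₂, h₂⟩ := exists_mem_generatedBy h2 (S := {lam1 k, lam2 k, sig k}) (M := lam2 k)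
    (by simp) (by simp)
  obtain ⟨g₃, hg₃, h₃⟩ := exists_mem_generatedBy h2 (S := {lam1 k, lam2 k, sig k}) (M := sig k)
    (by simp) (by simp)
  have a₁ := (ratAct_lam1 h₁).2
  have a₂ := (ratAct_lam2 h₂).2
  have a₃ := (ratAct_sig (two_ne_zero_ratFun4 h2) h₃).2
  obtain ⟨ha, hb, hc, hd₁, hd₂, hd₃⟩ := hF
  have m₁ : ratAct g₁ ∈ automorphisms G := ⟨g₁, hG hg₁, rfl⟩
  have m₂ : ratAct g₂ ∈ automorphisms G := ⟨g₂, hG hg₂, rfl⟩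
  have m₃ : ratAct g₃ ∈ automorphisms G := ⟨g₃, hG hg₃, rfl⟩
  refine (F.descent m₁ m₂ m₃ hB ?_ ?_ ?_ ?_ ?_ ?_ ?_ ?_ ?_ ?_ ?_ ?_ ?_ ?_ ?_ ?_ ?_ ?_).mono
    subset_rfl ?_
  on_goal 19 =>
    rw [IntermediateField.adjoin_le_iff]
    set M := IntermediateField.adjoin k ({F.a, F.b, F.c, F.d₁, F.d₂, F.d₃} ∪ B)
    have hsub : ∀ {x}, x ∈ ({F.a, F.b, F.c, F.d₁, F.d₂, F.d₃} ∪ B : Set (RatFun4 k)) → x ∈ M :=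
      fun hx => IntermediateField.subset_adjoin _ _ hx
    have hdiv := div_mem_of_rot_mem (two_ne_zero_ratFun4 h2) nsq_var_ne_zero (var_ne_zero 3)
      (hrot M (hsub (by simp)) (hsub (by simp)) (hsub (by simp)) (hsub (by simp)) (hsub (by simp))
        (hsub (by simp)))
    rintro x ((rfl | rfl | rfl) | hx)
    exacts [hdiv 0, hdiv 1, hdiv 2, hsub (Or.inr hx)]
  all_goals simp only [ha, hb, hc, hd₁, hd₂, hd₃, map_sum, map_mul, map_intCast, a₁, a₂, a₃,
    mul_neg, Finset.sum_neg_distrib]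

end ColumnFrame

/-! ### Enlarging the group -/

section Steps
variable {x y z x' y' z' : RatFun4 k} {g : GL (Fin 4) k}

theorem Generates.congr (h : Generates G x y z)
    (e : IntermediateField.adjoin k {x, y, z} = IntermediateField.adjoin k {x', y', z'}) :
    Generates G x' y' z' := by
  intro B hB
  have := h B hB
  rwa [IntermediateField.adjoin_union k (S := {x, y, z}), e,
    ← IntermediateField.adjoin_union] at this

theorem Generates.rotation (h : Generates G x y z) (hgG : g ∈ G) (h2 : (2 : k) ≠ 0)
    (h3 : (3 : k) ≠ 0) (hN : x ^ 2 + 3 * y ^ 2 ≠ 0) (hx : ratAct g x = -(x + 3 * y) / 2)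
    (hy : ratAct g y = (x - y) / 2) (hz : ratAct g z = z) :
    Generates G ((x ^ 3 - 9 * x * y ^ 2) / (x ^ 2 + 3 * y ^ 2))
      ((3 * x ^ 2 * y - 3 * y ^ 3) / (x ^ 2 + 3 * y ^ 2)) z := by
  intro B hB
  have hmem : ratAct g ∈ automorphisms G := ⟨g, hgG, rfl⟩
  have hd := (Descent.rotation (S := {z} ∪ B) hmem (two_ne_zero_ratFun4 h2)
    (three_ne_zero_ratFun4 h3) hN (by
      rintro t (rfl | ht)
      exacts [hz, hB _ hmem _ ht]) hx hy).2
  have e : ∀ a b : RatFun4 k, ({a, b} ∪ ({z} ∪ B) : Set (RatFun4 k)) = {a, b, z} ∪ B :=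
    fun a b => by rw [← Set.union_assoc, Set.insert_union, Set.singleton_union]
  rw [e, e] at hd
  exact (h B hB).trans hd

theorem Generates.inversion {c : RatFun4 k} {α β γ : k} (h : Generates G x y z) (hgG : g ∈ G)
    (h2 : (2 : k) ≠ 0)
    (hc : c = algebraMap k _ α * x ^ 2 + algebraMap k _ β * y ^ 2 + algebraMap k _ γ * z ^ 2)
    (hind : AlgebraicIndependent k ![x, y, z])
    (hx : ratAct g x = x / c) (hy : ratAct g y = -y / c) (hz : ratAct g z = z / c) :
    Generates G ((1 + c) / z) (x / z) ((1 - c) / y) := by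
  intro B hB
  have hmem : ratAct g ∈ automorphisms G := ⟨g, hgG, rfl⟩
  exact (h B hB).trans (Descent.inversion (S := B) hmem (two_ne_zero_ratFun4 h2) hc hind
    (fun t ht => hB _ hmem _ ht) hx hy hz).2

theorem map_inversion_of_fixed {E : Type*} [Field E] [Algebra k E] {e : E ≃ₐ[k] E}
    {c x y z : E} (hc : e c = c) (hx : e x = x) (hy : e y = y) (hz : e z = z) :
    e ((1 + c) / z) = (1 + c) / z ∧ e (x / z) = x / z ∧ e ((1 - c) / y) = (1 - c) / y := by
  simp only [map_div₀, map_add, map_sub, map_one, hc, hx, hy, hz, and_self]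

theorem Generates.isPurelyGenerated_generatedBy {S : Set (Matrix (Fin 4) (Fin 4) k)}
    (h : Generates (generatedBy S) x y z) (h2 : (2 : k) ≠ 0)
    (hS : S ⊆ {lam1 k, lam2 k, sig k, tau k, lam3 k, lam4 k}) (hG : group3 k ≤ generatedBy S)
    (hproj : x ∈ projField k ∧ y ∈ projField k ∧ z ∈ projField k)
    (hfix : ∀ g : GL (Fin 4) k, (g : Matrix (Fin 4) (Fin 4) k) ∈ S →
      ratAct g x = x ∧ ratAct g y = y ∧ ratAct g z = z) :
    IsPurelyGenerated (fixedField (generatedBy S)) ∧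
      IsPurelyGenerated (projFixedField (generatedBy S)) := by
  obtain ⟨g, hgG, hg⟩ := exists_neg_mem h2 hG
  exact h.isPurelyGenerated h2 (nsq_mem_fixedField h2 hS) hgG hg
    ⟨hproj.1, (fixedField_generatedBy S).2 fun g hg => (hfix g hg).1⟩
    ⟨hproj.2.1, (fixedField_generatedBy S).2 fun g hg => (hfix g hg).2.1⟩
    ⟨hproj.2.2, (fixedField_generatedBy S).2 fun g hg => (hfix g hg).2.2⟩

end Steps

theorem inversion_mem {E : Type*} [Field E] [Algebra k E] {M : IntermediateField k E}
    {c x y z : E} (hc : c ∈ M) (hx : x ∈ M) (hy : y ∈ M) (hz : z ∈ M) :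
    (1 + c) / z ∈ M ∧ x / z ∈ M ∧ (1 - c) / y ∈ M :=
  ⟨div_mem (add_mem (one_mem _) hc) hz, div_mem hx hz, div_mem (sub_mem (one_mem _) hc) hy⟩

/-! ### The groups `group3` and `group6` -/

section Coordinate

variable (h2 : (2 : k) ≠ 0)

/-- The frame of the middle and last columns of the rotation matrix of the variables. -/
noncomputable abbrev coordinate : Frame (RatFun4 k) 1 1 :=
  coordinateFrame (var k) (two_ne_zero_ratFun4 h2) nsq_var_ne_zero (isGenericAxis_coordinate h2)

theorem isColumnFrame_coordinate : IsColumnFrame (coordinate h2) ![0, 1, 0] ![0, 0, 1] := by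
  constructor <;> simp [coordinate, coordinateFrame, Fin.sum_univ_three]

theorem generates_coordinate (hG : group3 k ≤ G) :
    Generates G (coordinate h2).X (coordinate h2).Y (coordinate h2).w := by
  refine (isColumnFrame_coordinate h2).generates h2 hG fun M ha hb hc hd₁ hd₂ hd₃ => ?_
  obtain ⟨e₁, e₂, e₃⟩ := coordinateFrame_e (var k) (two_ne_zero_ratFun4 h2) nsq_var_ne_zero
    (isGenericAxis_coordinate h2)
  have h₁ : rot (var k) 0 0 ∈ M := e₁ ▸ sub_mem (mul_mem hb hd₃) (mul_mem hc hd₂)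
  have h₂ : rot (var k) 1 0 ∈ M := e₂ ▸ sub_mem (mul_mem hc hd₁) (mul_mem ha hd₃)
  have h₃ : rot (var k) 2 0 ∈ M := e₃ ▸ sub_mem (mul_mem ha hd₂) (mul_mem hb hd₁)
  intro i j
  fin_cases i <;> fin_cases j
  exacts [h₁, ha, hd₁, h₂, hb, hd₂, h₃, hc, hd₃]

theorem isPurelyGenerated_group3 (h2 : (2 : k) ≠ 0) :
    IsPurelyGenerated (fixedField (group3 k)) ∧ IsPurelyGenerated (projFixedField (group3 k)) :=
  (generates_coordinate h2 le_rfl).isPurelyGenerated_generatedBy h2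
    (by intro x; simp only [Set.mem_insert_iff, Set.mem_singleton_iff]; tauto) le_rfl
    (isColumnFrame_coordinate h2).XYw_mem_projField
    fun _ hg => (isColumnFrame_coordinate h2).map_group3 h2 hg

theorem isPurelyGenerated_group6 (h2 : (2 : k) ≠ 0) :
    IsPurelyGenerated (fixedField (group6 k)) ∧ IsPurelyGenerated (projFixedField (group6 k)) := by
  have hle : group3 k ≤ group6 k := Subgroup.closure_mono fun g hg => by
    simp only [Set.mem_ofPred_eq, Set.mem_insert_iff, Set.mem_singleton_iff] at hg ⊢; tauto
  have h2' := two_ne_zero_ratFun4 h2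
  have hF := isColumnFrame_coordinate h2
  set F := coordinate h2
  obtain ⟨hXp, hYp, hwp⟩ := hF.XYw_mem_projField
  obtain ⟨g, hgG, hg⟩ := exists_mem_generatedBy h2 (S := {lam1 k, lam2 k, sig k, tau k})
    (M := tau k) (by simp) (by simp)
  have hc : F.t = algebraMap k _ (1 / 2) * (F.X - F.Y) ^ 2 + algebraMap k _ (1 / 2) *
      (F.X + F.Y) ^ 2 + algebraMap k _ 1 * F.w ^ 2 := by
    have := F.quadric
    push_cast at this
    rw [map_div₀, map_one, map_ofNat]
    field_simp
    linear_combination -2 * this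
  have hgen : Generates (group6 k) (F.X - F.Y) (F.X + F.Y) F.w := by
    refine (generates_coordinate h2 hle).congr (le_antisymm ?_ ?_)
    · rw [IntermediateField.adjoin_le_iff]
      set M := IntermediateField.adjoin k {F.X - F.Y, F.X + F.Y, F.w}
      have hs : F.X - F.Y ∈ M := IntermediateField.subset_adjoin _ _ (by simp)
      have ht : F.X + F.Y ∈ M := IntermediateField.subset_adjoin _ _ (by simp)
      have hw : F.w ∈ M := IntermediateField.subset_adjoin _ _ (by simp)
      have htwo : (2 : RatFun4 k) ∈ M := ofNat_mem _ 2
      have hX : F.X ∈ M := by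
        have : F.X = ((F.X - F.Y) + (F.X + F.Y)) / 2 := by field_simp; ring
        exact this ▸ div_mem (add_mem hs ht) htwo
      have hY : F.Y ∈ M := by
        have : F.Y = ((F.X + F.Y) - (F.X - F.Y)) / 2 := by field_simp; ring
        exact this ▸ div_mem (sub_mem ht hs) htwo
      rintro x (rfl | rfl | rfl)
      exacts [hX, hY, hw]
    · rw [IntermediateField.adjoin_le_iff]
      set M := IntermediateField.adjoin k {F.X, F.Y, F.w}
      have hX : F.X ∈ M := IntermediateField.subset_adjoin _ _ (by simp)
      have hY : F.Y ∈ M := IntermediateField.subset_adjoin _ _ (by simp)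
      have hw : F.w ∈ M := IntermediateField.subset_adjoin _ _ (by simp)
      rintro x (rfl | rfl | rfl)
      exacts [sub_mem hX hY, add_mem hX hY, hw]
  have hind : AlgebraicIndependent k ![F.X - F.Y, F.X + F.Y, F.w] := by
    obtain ⟨g', hgG', hg'⟩ := exists_neg_mem h2 hle
    exact hgen.algebraicIndependent h2 (nsq_mem_fixedField h2 (by
      intro x; simp only [Set.mem_insert_iff, Set.mem_singleton_iff]; tauto)) hgG' hg'
  have hmap : ∀ g : GL (Fin 4) k, (g : Matrix (Fin 4) (Fin 4) k) = tau k →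
      ratAct g (F.X - F.Y) = (F.X - F.Y) / F.t ∧ ratAct g (F.X + F.Y) = -(F.X + F.Y) / F.t ∧
        ratAct g F.w = F.w / F.t := by
    intro g hg
    have a := (ratAct_tau hg).2
    obtain ⟨e₁, e₂, e₃⟩ := coordinateFrame_e (var k) (two_ne_zero_ratFun4 h2) nsq_var_ne_zero
      (isGenericAxis_coordinate h2)
    have ha : ratAct g F.a = -F.c := (a 1).1
    have hb : ratAct g F.b = F.b := (a 1).2.1
    have hc : ratAct g F.c = -F.a := (a 1).2.2
    obtain ⟨hX, hY⟩ := F.map_flip_swap ha hb hc ((a 2).1.trans (congrArg _ e₃.symm))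
      ((a 2).2.1.trans e₂.symm) ((a 2).2.2.trans (congrArg _ e₁.symm))
    refine ⟨?_, ?_, (F.map_flip ha hb hc).2.2.2.1⟩
    · rw [map_sub, hX, hY]; ring
    · rw [map_add, hX, hY]; ring
  obtain ⟨hs, ht, hw⟩ := hmap g hg
  refine (hgen.inversion hgG h2 hc hind hs ht hw).isPurelyGenerated_generatedBy h2
    (by intro x; simp only [Set.mem_insert_iff, Set.mem_singleton_iff]; tauto) hle
    (inversion_mem (F.t_mem hXp hYp hwp) (sub_mem hXp hYp) (add_mem hXp hYp) hwp) ?_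
  intro g' hg'
  by_cases hτ : (g' : Matrix (Fin 4) (Fin 4) k) = tau k
  · obtain ⟨hs, ht, hw⟩ := hmap g' hτ
    exact (Descent.inversion (Γ := Set.univ) (S := ∅) (Set.mem_univ _) h2' hc hind (by simp)
      hs ht hw).1
  · obtain ⟨hX, hY, hw⟩ := hF.map_group3 h2 (g := g') (by
      simp only [Set.mem_insert_iff, Set.mem_singleton_iff] at hg' ⊢; tauto)
    have hs : ratAct g' (F.X - F.Y) = F.X - F.Y := by rw [map_sub, hX, hY]
    have ht : ratAct g' (F.X + F.Y) = F.X + F.Y := by rw [map_add, hX, hY]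
    refine map_inversion_of_fixed ?_ hs ht hw
    rw [hc]
    simp only [map_add, map_mul, map_pow, AlgEquiv.commutes, hs, ht, hw]

end Coordinate

/-! ### The groups `group7` and `group11` -/

section Diagonal

variable (h2 : (2 : k) ≠ 0) (h3 : (3 : k) ≠ 0)

/-- The frame of `diagonalFrame` for the rotation matrix of the variables. -/
noncomputable abbrev diagonal : Frame (RatFun4 k) 3 2 :=
  diagonalFrame (var k) (two_ne_zero_ratFun4 h2) (three_ne_zero_ratFun4 h3) nsq_var_ne_zero
    (isGenericAxis_diagonal h2 h3)

theorem isColumnFrame_diagonal : IsColumnFrame (diagonal h2 h3) ![1, 1, -1] ![1, -1, 0] := by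
  constructor <;> simp [diagonal, diagonalFrame, Fin.sum_univ_three] <;> ring

theorem diagonal_e :
    (diagonal h2 h3).e₁ = -(rot (var k) 0 0 + rot (var k) 0 1 + 2 * rot (var k) 0 2) ∧
    (diagonal h2 h3).e₂ = -(rot (var k) 1 0 + rot (var k) 1 1 + 2 * rot (var k) 1 2) ∧
    (diagonal h2 h3).e₃ = -(rot (var k) 2 0 + rot (var k) 2 1 + 2 * rot (var k) 2 2) :=
  diagonalFrame_e (var k) (two_ne_zero_ratFun4 h2) (three_ne_zero_ratFun4 h3) nsq_var_ne_zero
    (isGenericAxis_diagonal h2 h3)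

theorem generates_diagonal (hG : group3 k ≤ G) :
    Generates G (diagonal h2 h3).X (diagonal h2 h3).Y (diagonal h2 h3).w := by
  refine (isColumnFrame_diagonal h2 h3).generates h2 hG fun M ha hb hc hd₁ hd₂ hd₃ => ?_
  have h2' := two_ne_zero_ratFun4 h2
  have h3' := three_ne_zero_ratFun4 h3
  obtain ⟨e₁, e₂, e₃⟩ := diagonal_e h2 h3
  have h₁ : (diagonal h2 h3).e₁ ∈ M := sub_mem (mul_mem hb hd₃) (mul_mem hc hd₂)
  have h₂ : (diagonal h2 h3).e₂ ∈ M := sub_mem (mul_mem hc hd₁) (mul_mem ha hd₃)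
  have h₃ : (diagonal h2 h3).e₃ ∈ M := sub_mem (mul_mem ha hd₂) (mul_mem hb hd₁)
  rw [e₁] at h₁
  rw [e₂] at h₂
  rw [e₃] at h₃
  have key : ∀ {r₀ r₁ r₂ : RatFun4 k}, r₀ + r₁ - r₂ ∈ M → r₀ - r₁ ∈ M →
      -(r₀ + r₁ + 2 * r₂) ∈ M → r₀ ∈ M ∧ r₁ ∈ M ∧ r₂ ∈ M := by
    intro r₀ r₁ r₂ ha hd he
    have hr₂ : r₂ ∈ M := by
      have : r₂ = -((r₀ + r₁ - r₂) + -(r₀ + r₁ + 2 * r₂)) / 3 := by field_simp; ring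
      exact this ▸ div_mem (neg_mem (add_mem ha he)) (ofNat_mem _ 3)
    refine ⟨?_, ?_, hr₂⟩
    · have : r₀ = ((r₀ + r₁ - r₂) + r₂ + (r₀ - r₁)) / 2 := by field_simp; ring
      exact this ▸ div_mem (add_mem (add_mem ha hr₂) hd) (ofNat_mem _ 2)
    · have : r₁ = ((r₀ + r₁ - r₂) + r₂ - (r₀ - r₁)) / 2 := by field_simp; ring
      exact this ▸ div_mem (sub_mem (add_mem ha hr₂) hd) (ofNat_mem _ 2)
  have k₁ := key ha hd₁ h₁
  have k₂ := key hb hd₂ h₂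
  have k₃ := key hc hd₃ h₃
  intro i j
  fin_cases i <;> fin_cases j
  exacts [k₁.1, k₁.2.1, k₁.2.2, k₂.1, k₂.2.1, k₂.2.2, k₃.1, k₃.2.1, k₃.2.2]

theorem diagonal_map_lam3 {g : GL (Fin 4) k} (hg : (g : Matrix (Fin 4) (Fin 4) k) = lam3 k) :
    ratAct g (diagonal h2 h3).X = -((diagonal h2 h3).X + 3 * (diagonal h2 h3).Y) / 2 ∧
    ratAct g (diagonal h2 h3).Y = ((diagonal h2 h3).X - (diagonal h2 h3).Y) / 2 ∧
    ratAct g (diagonal h2 h3).w = (diagonal h2 h3).w := by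
  have h2' := two_ne_zero_ratFun4 h2
  have a := (ratAct_lam3 h2' hg).2
  obtain ⟨e₁, e₂, e₃⟩ := diagonal_e h2 h3
  apply Frame.map_rotate
  on_goal 4 => rw [e₁]
  on_goal 5 => rw [e₂]
  on_goal 6 => rw [e₃]
  all_goals
    simp only [diagonal, diagonalFrame, map_sub, map_add, a]
    field_simp
    ring

theorem diagonal_map_lam4 {g : GL (Fin 4) k} (hg : (g : Matrix (Fin 4) (Fin 4) k) = lam4 k) :
    ratAct g (diagonal h2 h3).X =
      ((diagonal h2 h3).X - 3 * (diagonal h2 h3).Y) / (2 * (diagonal h2 h3).t) ∧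
    ratAct g (diagonal h2 h3).Y =
      -((diagonal h2 h3).X + (diagonal h2 h3).Y) / (2 * (diagonal h2 h3).t) ∧
    ratAct g (diagonal h2 h3).w = (diagonal h2 h3).w / (diagonal h2 h3).t := by
  have h2' := two_ne_zero_ratFun4 h2
  obtain ⟨-, a, b₀, b₁, b₂⟩ := ratAct_lam4 hg
  have a₀ := a 0 (by decide)
  have a₂ := a 2 (by decide)
  simp only [sub_zero, sub_self] at a₀ a₂
  obtain ⟨e₁, e₂, e₃⟩ := diagonal_e h2 h3
  have ha : ratAct g (diagonal h2 h3).a = -(diagonal h2 h3).c := by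
    simp only [diagonal, diagonalFrame, map_sub, map_add, a₀, a₂, b₀]; ring
  have hb : ratAct g (diagonal h2 h3).b = (diagonal h2 h3).b := by
    simp only [diagonal, diagonalFrame, map_sub, map_add, a₀, a₂, b₁]; ring
  have hc : ratAct g (diagonal h2 h3).c = -(diagonal h2 h3).a := by
    simp only [diagonal, diagonalFrame, map_sub, map_add, a₀, a₂, b₂]; ring
  refine ⟨?_, ?_, (Frame.map_flip _ ha hb hc).2.2.2.1⟩
  on_goal 1 => refine (Frame.map_flip_reflect _ ha hb hc ?_ ?_ ?_).1
  on_goal 4 => refine (Frame.map_flip_reflect _ ha hb hc ?_ ?_ ?_).2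
  on_goal 1 => rw [e₃]
  on_goal 2 => rw [e₂]
  on_goal 3 => rw [e₁]
  on_goal 4 => rw [e₃]
  on_goal 5 => rw [e₂]
  on_goal 6 => rw [e₁]
  all_goals
    simp only [diagonal, diagonalFrame, map_sub, a₀, b₀, b₁, b₂]
    field_simp
    ring

/-- The real component of `z³ / |z|²`, for `z = X + √-3 Y`. -/
noncomputable def diagonalM₁ : RatFun4 k :=
  ((diagonal h2 h3).X ^ 3 - 9 * (diagonal h2 h3).X * (diagonal h2 h3).Y ^ 2) /
    ((diagonal h2 h3).X ^ 2 + 3 * (diagonal h2 h3).Y ^ 2)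

/-- The component along `√-3` of `z³ / |z|²`, for `z = X + √-3 Y`. -/
noncomputable def diagonalM₂ : RatFun4 k :=
  (3 * (diagonal h2 h3).X ^ 2 * (diagonal h2 h3).Y - 3 * (diagonal h2 h3).Y ^ 3) /
    ((diagonal h2 h3).X ^ 2 + 3 * (diagonal h2 h3).Y ^ 2)

theorem diagonal_norm_ne_zero : (diagonal h2 h3).X ^ 2 + 3 * (diagonal h2 h3).Y ^ 2 ≠ 0 := by
  simpa using (diagonal h2 h3).normXY_ne

/-- The quadratic form for the inversion by `lam4`, as `z³ / |z|²` has the same norm as `z`. -/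
theorem diagonal_t_eq : (diagonal h2 h3).t = algebraMap k _ (2 / 3) * diagonalM₂ h2 h3 ^ 2 +
    algebraMap k _ (2 / 9) * diagonalM₁ h2 h3 ^ 2 +
      algebraMap k _ (1 / 3) * (diagonal h2 h3).w ^ 2 := by
  have h3' := three_ne_zero_ratFun4 h3
  have h9 : (9 : RatFun4 k) ≠ 0 := by
    rw [show (9 : RatFun4 k) = 3 * 3 by norm_num]; exact mul_ne_zero h3' h3'
  have hN := diagonal_norm_ne_zero h2 h3
  have hq := (diagonal h2 h3).quadric
  push_cast at hq
  have hm : diagonalM₁ h2 h3 ^ 2 + 3 * diagonalM₂ h2 h3 ^ 2 =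
      (diagonal h2 h3).X ^ 2 + 3 * (diagonal h2 h3).Y ^ 2 := by
    rw [diagonalM₁, diagonalM₂, div_pow, div_pow, mul_div_assoc', ← add_div,
      div_eq_iff (pow_ne_zero 2 hN)]
    ring
  simp only [map_div₀, map_ofNat, map_one]
  field_simp
  linear_combination -3 * hq - 6 * hm

theorem generates_diagonalM (hG : group3 k ≤ G) {g : GL (Fin 4) k} (hgG : g ∈ G)
    (hg : (g : Matrix (Fin 4) (Fin 4) k) = lam3 k) :
    Generates G (diagonalM₁ h2 h3) (diagonalM₂ h2 h3) (diagonal h2 h3).w := by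
  obtain ⟨hX, hY, hw⟩ := diagonal_map_lam3 h2 h3 hg
  exact (generates_diagonal h2 h3 hG).rotation hgG h2 h3 (diagonal_norm_ne_zero h2 h3) hX hY hw

theorem diagonalM_mem_projField : diagonalM₁ h2 h3 ∈ projField k ∧ diagonalM₂ h2 h3 ∈ projField k ∧
    (diagonal h2 h3).w ∈ projField k := by
  obtain ⟨hX, hY, hw⟩ := (isColumnFrame_diagonal h2 h3).XYw_mem_projField
  have h3 : (3 : RatFun4 k) ∈ projField k := ofNat_mem _ 3
  have h9 : (9 : RatFun4 k) ∈ projField k := ofNat_mem _ 9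
  refine ⟨?_, ?_, hw⟩
  · rw [diagonalM₁]; apply_rules [pow_mem, div_mem, sub_mem, add_mem, mul_mem]
  · rw [diagonalM₂]; apply_rules [pow_mem, div_mem, sub_mem, add_mem, mul_mem]

theorem diagonalM_map {g : GL (Fin 4) k}
    (hg : (g : Matrix (Fin 4) (Fin 4) k) ∈ ({lam1 k, lam2 k, sig k, lam3 k} : Set _)) :
    ratAct g (diagonalM₁ h2 h3) = diagonalM₁ h2 h3 ∧
      ratAct g (diagonalM₂ h2 h3) = diagonalM₂ h2 h3 ∧
      ratAct g (diagonal h2 h3).w = (diagonal h2 h3).w := by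
  by_cases hl : (g : Matrix (Fin 4) (Fin 4) k) = lam3 k
  · obtain ⟨hX, hY, hw⟩ := diagonal_map_lam3 h2 h3 hl
    have := (Descent.rotation (Γ := Set.univ) (S := ∅) (Set.mem_univ _) (two_ne_zero_ratFun4 h2)
      (three_ne_zero_ratFun4 h3) (diagonal_norm_ne_zero h2 h3) (by simp) hX hY).1
    exact ⟨this.1, this.2, hw⟩
  · obtain ⟨hX, hY, hw⟩ := (isColumnFrame_diagonal h2 h3).map_group3 h2 (g := g) (by
      simp only [Set.mem_insert_iff, Set.mem_singleton_iff] at hg ⊢; tauto)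
    simp only [diagonalM₁, diagonalM₂, map_div₀, map_sub, map_add, map_mul, map_pow, map_ofNat,
      hX, hY, hw, and_self]

theorem diagonalM_map_lam4 {g : GL (Fin 4) k}
    (hg : (g : Matrix (Fin 4) (Fin 4) k) = lam4 k) :
    ratAct g (diagonalM₁ h2 h3) = -diagonalM₁ h2 h3 / (diagonal h2 h3).t ∧
      ratAct g (diagonalM₂ h2 h3) = diagonalM₂ h2 h3 / (diagonal h2 h3).t := by
  obtain ⟨hX, hY, hw⟩ := diagonal_map_lam4 h2 h3 hg
  have h2' := two_ne_zero_ratFun4 h2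
  have hN := diagonal_norm_ne_zero h2 h3
  have ht := (diagonal h2 h3).t_ne
  have hgN : ratAct g ((diagonal h2 h3).X ^ 2 + 3 * (diagonal h2 h3).Y ^ 2) =
      ((diagonal h2 h3).X ^ 2 + 3 * (diagonal h2 h3).Y ^ 2) / (diagonal h2 h3).t ^ 2 := by
    simp only [map_add, map_mul, map_pow, map_ofNat, hX, hY]
    field_simp
    ring
  constructor
  · rw [diagonalM₁, map_div₀, hgN]
    simp only [map_sub, map_mul, map_pow, map_ofNat, hX, hY]
    field_simp
    ring
  · rw [diagonalM₂, map_div₀, hgN]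
    simp only [map_sub, map_mul, map_pow, map_ofNat, hX, hY]
    field_simp
    ring

theorem isPurelyGenerated_group7 (h2 : (2 : k) ≠ 0) (h3 : (3 : k) ≠ 0) :
    IsPurelyGenerated (fixedField (group7 k)) ∧ IsPurelyGenerated (projFixedField (group7 k)) := by
  have hle : group3 k ≤ group7 k := Subgroup.closure_mono fun g hg => by
    simp only [Set.mem_ofPred_eq, Set.mem_insert_iff, Set.mem_singleton_iff] at hg ⊢; tauto
  obtain ⟨g, hgG, hg⟩ := exists_mem_generatedBy h2 (S := {lam1 k, lam2 k, sig k, lam3 k})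
    (M := lam3 k) (by simp) (by simp)
  exact (generates_diagonalM h2 h3 hle hgG hg).isPurelyGenerated_generatedBy h2
    (by intro x; simp only [Set.mem_insert_iff, Set.mem_singleton_iff]; tauto) hle
    (diagonalM_mem_projField h2 h3) fun _ => diagonalM_map h2 h3

theorem isPurelyGenerated_group11 (h2 : (2 : k) ≠ 0) (h3 : (3 : k) ≠ 0) :
    IsPurelyGenerated (fixedField (group11 k)) ∧
      IsPurelyGenerated (projFixedField (group11 k)) := by
  have hle : group3 k ≤ group11 k := Subgroup.closure_mono fun g hg => by
    simp only [Set.mem_ofPred_eq, Set.mem_insert_iff, Set.mem_singleton_iff] at hg ⊢; tauto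
  obtain ⟨g₃, hgG₃, hg₃⟩ := exists_mem_generatedBy h2 (S := {lam1 k, lam2 k, sig k, lam3 k, lam4 k})
    (M := lam3 k) (by simp) (by simp)
  obtain ⟨g₄, hgG₄, hg₄⟩ := exists_mem_generatedBy h2 (S := {lam1 k, lam2 k, sig k, lam3 k, lam4 k})
    (M := lam4 k) (by simp) (by simp)
  have hgen : Generates (group11 k) (diagonalM₂ h2 h3) (diagonalM₁ h2 h3) (diagonal h2 h3).w :=
    (generates_diagonalM h2 h3 hle hgG₃ hg₃).congr (by rw [Set.insert_comm])
  have hind : AlgebraicIndependent k ![diagonalM₂ h2 h3, diagonalM₁ h2 h3, (diagonal h2 h3).w] := by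
    obtain ⟨g', hgG', hg'⟩ := exists_neg_mem h2 hle
    exact hgen.algebraicIndependent h2 (nsq_mem_fixedField h2 (by
      intro x; simp only [Set.mem_insert_iff, Set.mem_singleton_iff]; tauto)) hgG' hg'
  have hc := diagonal_t_eq h2 h3
  obtain ⟨h₁, h₂⟩ := diagonalM_map_lam4 h2 h3 hg₄
  have hw := (diagonal_map_lam4 h2 h3 hg₄).2.2
  obtain ⟨p₁, p₂, p₃⟩ := diagonalM_mem_projField h2 h3
  obtain ⟨q₁, q₂, -⟩ := (isColumnFrame_diagonal h2 h3).XYw_mem_projField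
  refine (hgen.inversion hgG₄ h2 hc hind h₂ h₁ hw).isPurelyGenerated_generatedBy h2
    (by intro x; simp only [Set.mem_insert_iff, Set.mem_singleton_iff]; tauto) hle
    (inversion_mem ((diagonal h2 h3).t_mem q₁ q₂ p₃) p₂ p₁ p₃) ?_
  intro g hg
  by_cases hl : (g : Matrix (Fin 4) (Fin 4) k) = lam4 k
  · obtain ⟨h₁, h₂⟩ := diagonalM_map_lam4 h2 h3 hl
    exact (Descent.inversion (Γ := Set.univ) (S := ∅) (Set.mem_univ _) (two_ne_zero_ratFun4 h2)
      hc hind (by simp) h₂ h₁ (diagonal_map_lam4 h2 h3 hl).2.2).1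
  · obtain ⟨h₁, h₂, hw⟩ := diagonalM_map h2 h3 (g := g) (by
      simp only [Set.mem_insert_iff, Set.mem_singleton_iff] at hg ⊢; tauto)
    refine map_inversion_of_fixed ?_ h₂ h₁ hw
    rw [hc]
    simp only [map_add, map_mul, map_pow, AlgEquiv.commutes, h₁, h₂, hw]

end Diagonal

end
end KangZhou

theorem theorem1p3 {k : Type*} [Field k] (G : Subgroup (GL (Fin 4) k)) :
    (ringChar k ≠ 2 →
      KangZhou.InClassOf G (KangZhou.group3 k) ∨ KangZhou.InClassOf G (KangZhou.group6 k) →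
      KangZhou.IsRational k (KangZhou.fixedField G) ∧
        KangZhou.IsRational k (KangZhou.projFixedField G)) ∧
    (ringChar k ≠ 2 → ringChar k ≠ 3 →
      KangZhou.InClassOf G (KangZhou.group7 k) ∨ KangZhou.InClassOf G (KangZhou.group11 k) →
      KangZhou.IsRational k (KangZhou.fixedField G) ∧
        KangZhou.IsRational k (KangZhou.projFixedField G)) := by
  have hthree : ringChar k ≠ 3 → (3 : k) ≠ 0 := fun h h0 => by
    have hdvd : ringChar k ∣ 3 := (ringChar.spec k 3).1 (by exact_mod_cast h0)
    rcases (Nat.dvd_prime Nat.prime_three).1 hdvd with h1 | h1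
    · exact CharP.ringChar_ne_one h1
    · exact h h1
  constructor
  · intro hk2 hG
    have h2 : (2 : k) ≠ 0 := Ring.two_ne_zero hk2
    rcases hG with hG | hG
    · have h := KangZhou.isPurelyGenerated_group3 h2
      exact KangZhou.isRational_of_inClassOf hG h.1 h.2
    · have h := KangZhou.isPurelyGenerated_group6 h2
      exact KangZhou.isRational_of_inClassOf hG h.1 h.2
  · intro hk2 hk3 hG
    have h2 : (2 : k) ≠ 0 := Ring.two_ne_zero hk2
    rcases hG with hG | hG
    · have h := KangZhou.isPurelyGenerated_group7 h2 (hthree hk3)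
      exact KangZhou.isRational_of_inClassOf hG h.1 h.2
    · have h := KangZhou.isPurelyGenerated_group11 h2 (hthree hk3)
      exact KangZhou.isRational_of_inClassOf hG h.1 h.2
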